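/- Let $(W,S)$ be an irreducible finite Coxeter system of rank $n=|S|\ge 2$ with Coxeter graph $\Gamma$ (two generators are joined by an edge exactly when they do not commute). Let $\mathsf{Cox}(W,S)$ be the set of Coxeter elements, i.e. the products of all $n$ generators in some order. For $w\in\mathsf{Cox}(W,S)$ let $\Gamma_w$ be the orientation of $\Gamma$ in which an edge $\{s,t\}$ is directed from $s$ to $t$ if and only if $s$ comes before $t$ in a reduced expression of $w$. Let $\mathbf c$ be a reduced expression of a Coxeter element $c$, and let $h$ be the Coxeter number, i.e. the order of $c$. On the letters of the infinite word $\mathbf c^\infty=\mathbf c\,\mathbf c\,\mathbf c\cdots$ let $\sigma\prec\tau$ if and only if there is a subword $\sigma=\sigma_1,\sigma_2,\dots,\sigma_k=\tau$ with $k\ge 2$ in which the generators of any two consecutive letters do not commute. Let $\mathcal G_{\mathbf c^\infty}$ be the Hasse diagram of this order, with each covering relation $\sigma\mathrel{\prec\!\!\!\cdot}\tau$ directed from $\sigma$ to $\tau$. The *2-cover* $\mathcal C^2_{\mathbf c}$ is the directed graph whose vertices are the letters of $\mathbf c^h$ and whose directed edges are the images of the edges of $\mathcal G_{\mathbf c^\infty}$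 under the projection that sends each letter of copy number $hk+i$ of $\mathbf c$ ($k\ge 0$, $0\le i<h$) to the corresponding letter of copy number $i$. A *cut path* is a set $\kappa$ of edges of $\mathcal C^2_{\mathbf c}$ such that every directed cycle (without repeated vertices) of $\mathcal C^2_{\mathbf c}$ contains exactly one edge of $\kappa$. Let $\mathsf{CP}(\mathcal C^2_{\mathbf c})$ be the set of cut paths. Then for every cut path $\kappa$ there is a unique Coxeter element $c_\kappa\in\mathsf{Cox}(W,S)$ such that, for all $s,t\in S$, $s\to t$ is an edge of $\Gamma_{c_\kappa}$ if and only if $\kappa$ contains an edge from a copy of $s$ to a copy of $t$. The map $$\Phi:\mathsf{CP}(\mathcal C^2_{\mathbf c})\to\mathsf{Cox}(W,S),\qquad \kappa\mapsto c_\kappa,$$ is surjective, and $|\Phi^{-1}(w)|=h$ for every $w\in\mathsf{Cox}(W,S)$. In particular, $|\mathsf{CP}(\mathcal C^2_{\mathbf c})|=2^{n-1}h$. -/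

import Mathlib

namespace CutPaths

section Coxeter

variable {B W : Type*} [Group W] {M : CoxeterMatrix B}

/-- The Coxeter graph `Γ`: the generators `s` and `t` are joined when they do not commute. -/
def coxeterGraph (cs : CoxeterSystem M W) : SimpleGraph B where
  Adj s t := ¬ Commute (cs.simple s) (cs.simple t)
  symm := ⟨fun _ _ h h' => h h'.symm⟩
  loopless := ⟨fun s h => h (Commute.refl (cs.simple s))⟩

/-- A Coxeter system is irreducible when its Coxeter graph is connected. -/
def IsIrreducible (cs : CoxeterSystem M W) : Prop :=
  (coxeterGraph cs).Connected

/-- A word that contains every generator exactly once. -/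
structure IsCoxeterWord (c : List B) : Prop where
  nodup : c.Nodup
  mem : ∀ s : B, s ∈ c

/-- `Cox(W,S)`: the products of all generators in some order. -/
def Cox (cs : CoxeterSystem M W) : Set W :=
  {w | ∃ l : List B, IsCoxeterWord l ∧ cs.wordProd l = w}

/-- The orientation `Γ_w` of the Coxeter graph given by a Coxeter element `w`: the edge `{s,t}` is
directed from `s` to `t` when `s` comes before `t` in a reduced expression of `w`. -/
def coxeterOrientation (cs : CoxeterSystem M W) (w : W) : Digraph B where
  Adj s t := (coxeterGraph cs).Adj s t ∧
    ∃ l : List B, IsCoxeterWord l ∧ cs.wordProd l = w ∧ [s, t].Sublist l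

/-- The Coxeter number: the order of the Coxeter element with expression `c`. -/
noncomputable def coxeterNumber (cs : CoxeterSystem M W) (c : List B) : ℕ :=
  orderOf (cs.wordProd c)

/-- The (strict) natural partial order on the letters of a finite or infinite word. The letters are
the elements of `P`, ordered as in the word, and `g` assigns to a letter its generator. Then
`σ ≺ τ` when there is a subword that starts with `σ`, ends with `τ`, and whose consecutive letters
do not commute. -/
def naturalLT (cs : CoxeterSystem M W) {P : Type*} [LT P] (g : P → B) : P → P → Prop :=
  Relation.TransGen fun σ τ => σ < τ ∧ ¬ Commute (cs.simple (g σ)) (cs.simple (g τ))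

/-- The Hasse diagram of the natural partial order, each covering relation `σ ⋖ τ` being
directed from `σ` to `τ`. -/
def hasseDiagram (cs : CoxeterSystem M W) {P : Type*} [LT P] (g : P → B) : Digraph P where
  Adj σ τ := naturalLT cs g σ τ ∧ ¬ ∃ ρ, naturalLT cs g σ ρ ∧ naturalLT cs g ρ τ

/-- The letters of the infinite word `c^∞ = c c c ⋯`: the pair `(k, j)` is the letter at position
`j` of copy `k` of `c`. The lexicographic order is the order of the letters in `c^∞`. -/
abbrev InfLetter (c : List B) : Type := ℕ ×ₗ Fin c.length

/-- The generator of a letter of `c^∞`. -/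
def infGen (c : List B) (σ : InfLetter c) : B := c.get (ofLex σ).2

/-- The letters of `c^h`, with the `h` copies of `c` indexed by the residues modulo `h`. -/
abbrev CoverVertex (c : List B) (h : ℕ) : Type := ZMod h × Fin c.length

/-- The generator of a letter of `c^h`. -/
def coverGen (c : List B) (h : ℕ) (σ : CoverVertex c h) : B := c.get σ.2

/-- The projection from the letters of `c^∞` to those of `c^h`, which sends a letter of copy
`h * k + i` to the corresponding letter of copy `i`. -/
def coverProj (c : List B) (h : ℕ) (σ : InfLetter c) : CoverVertex c h :=
  (((ofLex σ).1 : ZMod h), (ofLex σ).2)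

/-- The `2`-cover: its vertices are the letters of `c^h`, where `h` is the Coxeter number, and its
directed edges are the projections of the edges of the Hasse diagram of `c^∞`. -/
def twoCover (cs : CoxeterSystem M W) (c : List B) :
    Digraph (CoverVertex c (coxeterNumber cs c)) where
  Adj σ τ := ∃ p q : InfLetter c, (hasseDiagram cs (infGen c)).Adj p q ∧
    coverProj c (coxeterNumber cs c) p = σ ∧ coverProj c (coxeterNumber cs c) q = τ

end Coxeter

/-- `v 0 → v 1 → ⋯ → v (k - 1) → v 0` is a directed cycle of the digraph `G`: consecutive vertices
are joined by a directed edge and no vertex is repeated. -/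
structure IsDirectedCycle {V : Type*} (G : Digraph V) {k : ℕ} (v : ZMod k → V) : Prop where
  pos : 0 < k
  injective : Function.Injective v
  adj : ∀ i, G.Adj (v i) (v (i + 1))

/-- A cut path: a set of directed edges such that every directed cycle contains exactly one of
them. -/
structure IsCutPath {V : Type*} (G : Digraph V) (κ : Set (V × V)) : Prop where
  adj : ∀ e ∈ κ, G.Adj e.1 e.2
  existsUnique : ∀ (k : ℕ) (v : ZMod k → V), IsDirectedCycle G v →
    ∃! i : ZMod k, (v i, v (i + 1)) ∈ κ

section TwoCover

variable {B W : Type*} [Group W] {M : CoxeterMatrix B}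

/-- The type of cut paths of the `2`-cover. -/
abbrev CutPath (cs : CoxeterSystem M W) (c : List B) : Type :=
  {κ : Set (CoverVertex c (coxeterNumber cs c) × CoverVertex c (coxeterNumber cs c)) //
    IsCutPath (twoCover cs c) κ}

/-- The orientation of the Coxeter graph induced by a cut path `κ`: there is a directed edge from
`s` to `t` when `κ` contains an edge from a copy of `s` to a copy of `t`. -/
def CutPath.orientation {cs : CoxeterSystem M W} {c : List B} (κ : CutPath cs c) : Digraph B where
  Adj s t := ∃ e ∈ κ.1, coverGen c _ e.1 = s ∧ coverGen c _ e.2 = t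

/-- `w` is a Coxeter element induced by the cut path `κ`: the orientation of the Coxeter graph
given by `w` is the one induced by `κ`. -/
def CutPath.Induces {cs : CoxeterSystem M W} {c : List B} (κ : CutPath cs c) (w : W) : Prop :=
  w ∈ Cox cs ∧ coxeterOrientation cs w = κ.orientation

end TwoCover

end CutPaths

/-! Averaging an inner product over the finite group makes the Coxeter graph Γ positive in the sense
of `IsPositiveGraph`. Hence Γ is a tree, and since it contains no affine E₆ its non-leaf vertices
form a path.

On a tree the 2-cover is explicit: it is the graph `cyclicCover` on `ZMod h × Γ` in which each edge
s → t raises the level by ε(s,t), with ε(s,t) + ε(t,s) = 1 (`twoCover_eq_cyclicCover`). Only `0 < h`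
matters from here on.

Fix an orientation D of Γ. A level function a with a(s) - a(t) = [s → t in D] - ε(s,t) turns x -
a(s) into a height modulo h on the vertices (x, s) of the cover: it rises by one along D and is
constant against D. The edges rising from -1 to 0 form a cut path provided that every simple cycle
winds exactly once (`isCutPath_levelCut`). A cycle winding w times has length 2hw. If w > 1, the
cycle and its translate by 2h project to two walkers on Γ that never meet, and an order on the
vertices of the same colour, preserved until a collision, rules this out
(`IsCrossingOrder.false_of_periodic`, `IsPositiveGraph.exists_isCrossingOrder`).

Conversely, testing a cut path on cycles that zigzag between one fibre and its neighbours shows that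
it is such a level cut (`exists_eq_levelCut`). As a is determined by D and its value at one vertex,
each D comes from exactly h cut paths. Finally, Coxeter elements correspond bijectively to
orientations of Γ, of which a tree on n vertices has 2^(n-1). -/

namespace CutPaths

/-! ### Geometric representation and positivity of the Cartan matrix -/

section Geometric

open Module Polynomial

variable {B W : Type*} [Group W] {M : CoxeterMatrix B}

/-- The entry `-2 cos (π / m)` of the Cartan matrix, which is `-2` when `m = ∞` (encoded as `0`). -/
noncomputable def cartanEntry (M : CoxeterMatrix B) (s t : B) : ℝ :=
  -2 * Real.cos (Real.pi / M s t)

theorem cartanEntry_self (M : CoxeterMatrix B) (s : B) : cartanEntry M s s = 2 := by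
  simp [cartanEntry]

theorem cartanEntry_comm (M : CoxeterMatrix B) (s t : B) :
    cartanEntry M s t = cartanEntry M t s := by
  simp [cartanEntry, M.symmetric s t]

theorem cartanEntry_nonpos (M : CoxeterMatrix B) {s t : B} (h : s ≠ t) :
    cartanEntry M s t ≤ 0 := by
  have h1 := M.off_diagonal s t h
  have : 0 ≤ Real.cos (Real.pi / M s t) := by
    rcases Nat.eq_zero_or_pos (M s t) with h0 | h0
    · simp [h0]
    · have h2 : (2 : ℝ) ≤ M s t := by exact_mod_cast (by omega : 2 ≤ M s t)
      apply Real.cos_nonneg_of_neg_pi_div_two_le_of_le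
      · have : 0 ≤ Real.pi / M s t := by positivity
        linarith [Real.pi_pos]
      · exact div_le_div_of_nonneg_left Real.pi_pos.le (by norm_num) h2
  unfold cartanEntry
  linarith

theorem cartanEntry_le_neg_one (cs : CoxeterSystem M W) {s t : B}
    (h : (coxeterGraph cs).Adj s t) : cartanEntry M s t ≤ -1 := by
  have hne : s ≠ t := h.ne
  have h1 := M.off_diagonal s t hne
  have h2 : M s t ≠ 2 := by
    intro h2
    apply h
    have h3 := cs.simple_mul_simple_pow s t
    rw [h2, pow_two] at h3
    have h4 := eq_inv_of_mul_eq_one_left h3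
    rw [mul_inv_rev, cs.inv_simple, cs.inv_simple] at h4
    exact h4
  have : 1 / 2 ≤ Real.cos (Real.pi / M s t) := by
    rcases Nat.eq_zero_or_pos (M s t) with h0 | h0
    -- For `M s t = 0` the quotient `π / 0` is `0`, so the cosine is `1`.
    · simp [h0]; norm_num
    · have h3 : (3 : ℝ) ≤ M s t := by exact_mod_cast (by omega : 3 ≤ M s t)
      rw [← Real.cos_pi_div_three]
      apply Real.cos_le_cos_of_nonneg_of_le_pi (by positivity)
      · linarith [Real.pi_pos]
      · exact div_le_div_of_nonneg_left Real.pi_pos.le (by norm_num) h3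
  unfold cartanEntry
  linarith

/-- The space of the geometric representation, extended by fundamental weights. -/
abbrev WeightSpace (B : Type*) : Type _ := (B → ℝ) × (B → ℝ)

open Classical in
/-- The simple root of a generator. -/
noncomputable def simpleRoot (s : B) : WeightSpace B := (Pi.single s 1, 0)

variable [Fintype B]

/-- The simple coroot of a generator, as a linear form. -/
noncomputable def simpleCoroot (M : CoxeterMatrix B) (s : B) : Dual ℝ (WeightSpace B) :=
  (∑ t, cartanEntry M s t • LinearMap.proj t) ∘ₗ LinearMap.fst ℝ _ _ +
    LinearMap.proj s ∘ₗ LinearMap.snd ℝ _ _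

theorem simpleCoroot_apply (s : B) (v : WeightSpace B) :
    simpleCoroot M s v = ∑ t, cartanEntry M s t * v.1 t + v.2 s := by
  simp [simpleCoroot]

theorem simpleCoroot_simpleRoot (s t : B) :
    simpleCoroot M s (simpleRoot t) = cartanEntry M s t := by
  classical
  simp [simpleCoroot_apply, simpleRoot, Pi.single_apply]

theorem simpleCoroot_simpleRoot_self (M : CoxeterMatrix B) (s : B) :
    simpleCoroot M s (simpleRoot s) = 2 := by
  rw [simpleCoroot_simpleRoot, cartanEntry_self]

/-- Two reflections whose Cartan numbers are both `-2 cos (π / m)` satisfy the braid relation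
of order `m`. -/
theorem reflection_mul_reflection_pow_eq_one {V : Type*} [AddCommGroup V] [Module ℝ V]
    {x y : V} {f g : Dual ℝ V} (hf : f x = 2) (hg : g y = 2) {m : ℕ} (hm : 2 ≤ m)
    (hfy : f y = -2 * Real.cos (Real.pi / m)) (hgx : g x = -2 * Real.cos (Real.pi / m)) :
    (reflection hf * reflection hg) ^ m = 1 := by
  set θ := Real.pi / m with hθ
  have hm0 : (0 : ℝ) < m := by exact_mod_cast (by omega : 0 < m)
  have hmθ : m * θ = Real.pi := by rw [hθ]; field_simp
  apply LinearEquiv.toLinearMap_injective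
  have ht : 2 * Real.cos (2 * θ) = f y * g x - 2 := by
    rw [hfy, hgx, Real.cos_two_mul]; ring
  rw [reflection_mul_reflection_pow hf hg m (2 * Real.cos (2 * θ)) ht]
  -- For `m = 2` one has sin 2θ = sin π = 0, which cannot be cancelled below.
  rcases hm.eq_or_lt with rfl | hm3
  · have hc : Real.cos θ = 0 := by rw [hθ]; exact_mod_cast Real.cos_pi_div_two
    have e1 : f y = 0 := by rw [hfy, hc, mul_zero]
    have e2 : g x = 0 := by rw [hgx, hc, mul_zero]
    have e3 : 2 * Real.cos (2 * θ) = -2 := by rw [ht, e1, e2]; ring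
    rw [e3, e1, e2]
    norm_num
    ext z
    simp only [LinearMap.add_apply, LinearMap.id_apply, LinearMap.sub_apply, LinearMap.neg_apply,
      LinearMap.smulRight_apply]
    module
  · have hsin : Real.sin (2 * θ) ≠ 0 := by
      apply ne_of_gt
      have h3 : (3 : ℝ) ≤ m := by exact_mod_cast hm3
      have hpos : 0 < θ := by positivity
      apply Real.sin_pos_of_pos_of_lt_pi (by positivity)
      nlinarith
    have key (k : ℤ) : (Chebyshev.S ℝ k).eval (2 * Real.cos (2 * θ)) * Real.sin (2 * θ) =
        Real.sin ((k + 1) * (2 * θ)) := Chebyshev.S_two_mul_real_cos _ _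
    -- The coefficients of the power formula contain S_(k-1) when m = 2k and S_k + S_(k-1) when m =
    -- 2k + 1. Both vanish at 2 cos 2θ because mθ = π.
    rcases Nat.even_or_odd' m with ⟨k, rfl | rfl⟩
    · have hS : (Chebyshev.S ℝ (k - 1)).eval (2 * Real.cos (2 * θ)) = 0 := by
        have := key (k - 1)
        rw [show (((k - 1 : ℤ) : ℝ) + 1) * (2 * θ) = Real.pi by
          rw [← hmθ]; push_cast; ring, Real.sin_pi] at this
        exact (mul_eq_zero.1 this).resolve_right hsin
      have i1 : (((2 * k : ℕ) : ℤ) - 2) / 2 = k - 1 := by omega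
      have i2 : (((2 * k : ℕ) : ℤ) - 1) / 2 = k - 1 := by omega
      rw [i1, i2, hS]
      simp
    · have hS : (Chebyshev.S ℝ k).eval (2 * Real.cos (2 * θ)) +
          (Chebyshev.S ℝ (k - 1)).eval (2 * Real.cos (2 * θ)) = 0 := by
        have h1 := key (k - 1)
        have h2 := key k
        rw [show (((k - 1 : ℤ) : ℝ) + 1) * (2 * θ) = Real.pi - θ by
          rw [← hmθ]; push_cast; ring, Real.sin_pi_sub] at h1
        rw [show (((k : ℤ) : ℝ) + 1) * (2 * θ) = θ + Real.pi by
          rw [← hmθ]; push_cast; ring, Real.sin_add_pi] at h2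
        have h3 : ((Chebyshev.S ℝ k).eval (2 * Real.cos (2 * θ)) +
          (Chebyshev.S ℝ (k - 1)).eval (2 * Real.cos (2 * θ))) * Real.sin (2 * θ) = 0 := by
          rw [add_mul, h1, h2]; ring
        exact (mul_eq_zero.1 h3).resolve_right hsin
      have i1 : (((2 * k + 1 : ℕ) : ℤ) - 2) / 2 = k - 1 := by omega
      have i2 : (((2 * k + 1 : ℕ) : ℤ) - 1) / 2 = k := by omega
      have i3 : (((2 * k + 1 : ℕ) : ℤ) - 3) / 2 = k - 1 := by omega
      have i4 : ((2 * k + 1 : ℕ) : ℤ) / 2 = k := by omega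
      rw [i1, i2, i3, i4, hS]
      simp

theorem isLiftable_reflection (M : CoxeterMatrix B) :
    M.IsLiftable fun s : B => reflection (simpleCoroot_simpleRoot_self M s) := by
  intro s t
  rcases eq_or_ne s t with rfl | hst
  · rw [M.diagonal, pow_one]
    ext1 v
    exact involutive_reflection _ v
  · rcases Nat.eq_zero_or_pos (M s t) with h0 | h0
    · rw [h0, pow_zero]
    · have := M.off_diagonal s t hst
      apply reflection_mul_reflection_pow_eq_one _ _ (by omega)
      · exact simpleCoroot_simpleRoot s t
      · rw [simpleCoroot_simpleRoot, cartanEntry_comm]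
        rfl

/-- The geometric representation, extended by fundamental weights. -/
noncomputable def geometricRep (cs : CoxeterSystem M W) :
    W →* (WeightSpace B ≃ₗ[ℝ] WeightSpace B) :=
  cs.lift ⟨_, isLiftable_reflection M⟩

theorem geometricRep_simple (cs : CoxeterSystem M W) (s : B) (v : WeightSpace B) :
    geometricRep cs (cs.simple s) v = v - simpleCoroot M s v • simpleRoot s := by
  rw [geometricRep, cs.lift_apply_simple (isLiftable_reflection M), reflection_apply]

open Classical in
/-- The Cartan matrix of a finite Coxeter group is positive: no nonzero nonnegative function on
its Coxeter graph is subharmonic on its support. -/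
theorem exists_sum_neighbors_lt [Finite W] (cs : CoxeterSystem M W) (b : B → ℝ)
    (hb : ∀ s, 0 ≤ b s) (hb0 : ∃ s, b s ≠ 0) :
    ∃ s, 0 < b s ∧ ∑ t with (coxeterGraph cs).Adj s t, b t < 2 * b s := by
  have := Fintype.ofFinite W
  -- The standard dot product averaged over the group, hence invariant.
  let ip (u v : WeightSpace B) : ℝ := ∑ w : W,
    (∑ i, (geometricRep cs w u).1 i * (geometricRep cs w v).1 i +
      ∑ i, (geometricRep cs w u).2 i * (geometricRep cs w v).2 i)
  have ip_add (u v v' : WeightSpace B) : ip u (v + v') = ip u v + ip u v' := by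
    simp only [ip, map_add, Prod.fst_add, Prod.snd_add, Pi.add_apply, mul_add,
      Finset.sum_add_distrib]
    ring
  have ip_smul (u v : WeightSpace B) (r : ℝ) : ip u (r • v) = r * ip u v := by
    simp only [ip, map_smul, Prod.smul_fst, Prod.smul_snd, Pi.smul_apply, smul_eq_mul,
      Finset.mul_sum, mul_add]
    simp only [mul_left_comm]
  have ip_comm (u v : WeightSpace B) : ip u v = ip v u := by
    simp only [ip, mul_comm]
  have ip_inv (w : W) (u v : WeightSpace B) :
      ip (geometricRep cs w u) (geometricRep cs w v) = ip u v := by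
    simp only [ip]
    refine Fintype.sum_equiv (Equiv.mulRight w) _ _ fun x => ?_
    simp [map_mul]
  have ip_pos (u : WeightSpace B) (hu : u.1 ≠ 0) : 0 < ip u u := by
    have hnn (w : W) : 0 ≤ ∑ i, (geometricRep cs w u).1 i * (geometricRep cs w u).1 i +
      ∑ i, (geometricRep cs w u).2 i * (geometricRep cs w u).2 i :=
      add_nonneg (Finset.sum_nonneg fun i _ => mul_self_nonneg _)
        (Finset.sum_nonneg fun i _ => mul_self_nonneg _)
    refine Finset.sum_pos' (fun w _ => hnn w) ⟨1, Finset.mem_univ _, ?_⟩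
    obtain ⟨i, hi⟩ := Function.ne_iff.1 hu
    refine add_pos_of_pos_of_nonneg ?_ (Finset.sum_nonneg fun i _ => mul_self_nonneg _)
    refine Finset.sum_pos' (fun i _ => mul_self_nonneg _) ⟨i, Finset.mem_univ _, ?_⟩
    simpa using mul_self_pos.2 hi
  have ip_coroot (s : B) (v : WeightSpace B) :
      2 * ip (simpleRoot s) v = simpleCoroot M s v * ip (simpleRoot s) (simpleRoot s) := by
    have h1 := ip_inv (cs.simple s) (simpleRoot s) v
    rw [geometricRep_simple, geometricRep_simple, simpleCoroot_simpleRoot_self,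
      show simpleRoot s - (2 : ℝ) • simpleRoot s = (-1 : ℝ) • simpleRoot s by module,
      sub_eq_add_neg, ← neg_smul, ip_add, ip_smul, ip_comm _ v, ip_smul,
      ip_comm ((-1 : ℝ) • simpleRoot s), ip_smul, ip_comm v] at h1
    linarith
  have hroot (s : B) : 0 < ip (simpleRoot s) (simpleRoot s) := by
    apply ip_pos
    intro h
    simpa [simpleRoot] using congrFun h s
  let v : WeightSpace B := (b, 0)
  have hv : 0 < ip v v := ip_pos v (by obtain ⟨s, hs⟩ := hb0; exact fun h => hs (congrFun h s))
  have hvsum : v = ∑ s, b s • simpleRoot s := by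
    ext i
    · simp [v, simpleRoot, Prod.fst_sum, Finset.sum_apply, Pi.single_apply]
    · simp [v, simpleRoot, Prod.snd_sum]
  have ip_sum : ip v v = ∑ s, b s * ip (simpleRoot s) v := by
    conv_lhs => rw [ip_comm, hvsum]
    have h0 (F : Finset B) : ip v (∑ s ∈ F, b s • simpleRoot s) =
        ∑ s ∈ F, b s * ip (simpleRoot s) v := by
      induction F using Finset.induction_on with
      | empty => simpa using ip_smul v 0 0
      | insert s F hs ih => rw [Finset.sum_insert hs, Finset.sum_insert hs, ip_add, ih, ip_smul,
          ip_comm v]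
    rw [← hvsum, ← h0, ← hvsum]
  -- If `b` is subharmonic on its support, the coroots there are nonpositive on `v`, so `ip v v = ∑
  -- b s * ip (simpleRoot s) v ≤ 0`.
  by_contra! hcon
  have hle : ∀ s, b s * ip (simpleRoot s) v ≤ 0 := by
    intro s
    rcases (hb s).eq_or_lt with h0 | h0
    · simp [← h0]
    · have h1 : simpleCoroot M s v ≤ 0 := by
        have h2 : ∀ t, cartanEntry M s t * b t ≤
            (if s = t then 2 * b s else 0) - (if (coxeterGraph cs).Adj s t then b t else 0) := by
          intro t
          by_cases hst : s = t
          · subst hst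
            simp [cartanEntry_self]
          · by_cases hadj : (coxeterGraph cs).Adj s t
            · have := cartanEntry_le_neg_one cs hadj
              have := hb t
              simp only [hst, hadj, if_true, if_false]
              nlinarith
            · simp only [hst, hadj, if_false, sub_zero]
              exact mul_nonpos_of_nonpos_of_nonneg (cartanEntry_nonpos M hst) (hb t)
        have h3 := Finset.sum_le_sum fun t (_ : t ∈ Finset.univ) => h2 t
        rw [Finset.sum_sub_distrib, ← Finset.sum_filter (fun t => (coxeterGraph cs).Adj s t)] at h3
        simp only [Finset.sum_ite_eq, Finset.mem_univ, if_true] at h3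
        rw [simpleCoroot_apply]
        have := hcon s h0
        simp only [v, Pi.zero_apply, add_zero]
        linarith
      have := ip_coroot s v
      have h4 := hroot s
      have : ip (simpleRoot s) v ≤ 0 := by nlinarith
      exact mul_nonpos_of_nonneg_of_nonpos (hb s) this
  have := Finset.sum_nonpos fun s (_ : s ∈ Finset.univ) => hle s
  linarith

end Geometric

/-! ### Positive graphs and the crossing order -/

section PositiveGraph

variable {V : Type*} [Fintype V]

open Classical in
/-- A graph is positive when no nonzero nonnegative function on its vertices is, on its support, at
most half the sum over the neighbours. Dynkin diagrams of finite type are positive. -/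
def IsPositiveGraph (G : SimpleGraph V) : Prop :=
  ∀ b : V → ℝ, (∀ s, 0 ≤ b s) → (∃ s, b s ≠ 0) →
    ∃ s, 0 < b s ∧ ∑ t with G.Adj s t, b t < 2 * b s

variable {G : SimpleGraph V}

/-- The indicator function of a cycle violates positivity: each of its vertices has at least two
neighbours on the cycle. -/
theorem IsPositiveGraph.isAcyclic (hG : IsPositiveGraph G) : G.IsAcyclic := by
  classical
  intro v p hp
  obtain ⟨s, hs, hlt⟩ := hG (fun s => if s ∈ p.support then 1 else 0)
    (fun s => by split_ifs <;> norm_num) ⟨v, by simp⟩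
  have hsp : s ∈ p.support := by
    by_contra h
    simp [h] at hs
  have h2 := hp.ncard_neighborSet_toSubgraph_eq_two hsp
  simp only [hsp, if_true, Finset.sum_ite, Finset.sum_const_zero, add_zero, Finset.sum_const,
    nsmul_eq_mul, mul_one, Finset.filter_filter] at hlt
  have hsub : p.toSubgraph.neighborSet s ⊆
      ((Finset.univ.filter fun t => G.Adj s t ∧ t ∈ p.support : Finset V) : Set V) := by
    intro t ht
    have h3 : p.toSubgraph.Adj s t := ht
    simp only [Finset.coe_filter, Finset.mem_univ, true_and, Set.mem_ofPred_eq]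
    exact ⟨h3.adj_sub, p.mem_verts_toSubgraph.1 h3.snd_mem⟩
  have h4 := Set.ncard_le_ncard hsub
  rw [h2, Set.ncard_coe_finset] at h4
  exact absurd hlt (not_lt.2 (by exact_mod_cast h4))

open Classical in
/-- A positive graph admits no locally injective homomorphism from a finite graph that carries a
positive subharmonic function. -/
theorem IsPositiveGraph.not_subharmonic (hG : IsPositiveGraph G) {ι : Type*} [Fintype ι]
    (T : ι → ι → Prop) (f : ι → V) (w : ι → ℝ) (hw : ∀ i, 0 < w i) [Nonempty ι]
    (hom : ∀ i j, T i j → G.Adj (f i) (f j))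
    (inj : ∀ i i' j, T i j → T i' j → f i = f i' → i = i')
    (hsub : ∀ i, 2 * w i ≤ ∑ j, if T i j then w j else 0) : False := by
  obtain ⟨i₀⟩ := ‹Nonempty ι›
  have hnn : ∀ s, 0 ≤ ∑ i, if f i = s then w i else 0 := fun s =>
    Finset.sum_nonneg fun i _ => by split_ifs; exacts [(hw i).le, le_rfl]
  obtain ⟨s, -, hlt⟩ := hG (fun s => ∑ i, if f i = s then w i else 0) hnn
    ⟨f i₀, ne_of_gt <| Finset.sum_pos' (fun i _ => by split_ifs; exacts [(hw i).le, le_rfl])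
      ⟨i₀, Finset.mem_univ _, by simpa using hw i₀⟩⟩
  have h1 : ∑ t with G.Adj s t, ∑ i, (if f i = t then w i else 0) =
      ∑ j, if G.Adj s (f j) then w j else 0 := by
    rw [Finset.sum_comm]
    refine Finset.sum_congr rfl fun j _ => ?_
    rw [Finset.sum_ite_eq]
    simp
  -- The test function is the push-forward of `w` along `f`. By local injectivity each `j` is joined
  -- to at most one `i` above `s`.
  have h2 : ∀ j, ∑ i, (if f i = s then if T i j then w j else 0 else 0) ≤
      if G.Adj s (f j) then w j else 0 := by
    intro j
    by_cases hex : ∃ i, f i = s ∧ T i j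
    · obtain ⟨i, hi, hT⟩ := hex
      rw [Finset.sum_eq_single i]
      · rw [← hi]
        simp [hT, hom i j hT]
      · intro i' _ hne
        split_ifs with h3 h4
        · exact absurd (inj i' i j h4 hT (h3.trans hi.symm)) hne
        · rfl
        · rfl
      · simp
    · rw [Finset.sum_eq_zero]
      · split_ifs; exacts [(hw j).le, le_rfl]
      · intro i _
        split_ifs with h3 h4
        · exact absurd ⟨i, h3, h4⟩ hex
        · rfl
        · rfl
  have h3 := Finset.sum_le_sum fun j (_ : j ∈ Finset.univ) => h2 j
  rw [Finset.sum_comm, ← h1] at h3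
  have h4 : 2 * ∑ i, (if f i = s then w i else 0) ≤
      ∑ i, ∑ j, if f i = s then if T i j then w j else 0 else 0 := by
    rw [Finset.mul_sum]
    refine Finset.sum_le_sum fun i _ => ?_
    by_cases hi : f i = s
    · simpa [hi] using hsub i
    · simp [hi]
  linarith

/-- A vertex with at least two neighbours. -/
def IsInner (G : SimpleGraph V) (x : V) : Prop :=
  ∃ y z, y ≠ z ∧ G.Adj x y ∧ G.Adj x z

/-- The adjacency of the affine diagram `E₆`: three arms of length two at a centre. -/
def affineE6Adj : Option (Fin 3 × Bool) → Option (Fin 3 × Bool) → Prop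
  | none, some (_, false) => True
  | some (_, false), none => True
  | some (i, b), some (j, b') => i = j ∧ b ≠ b'
  | _, _ => False

/-- Three inner neighbours would give a locally injective map from affine E₆. The ends of the arms
need not be shown distinct. -/
theorem IsPositiveGraph.not_three_inner (hG : IsPositiveGraph G) (z : V) (p : Fin 3 → V)
    (hp : Function.Injective p) (hz : ∀ i, G.Adj z (p i)) (hin : ∀ i, IsInner G (p i)) :
    False := by
  classical
  have hq : ∀ i, ∃ q, q ≠ z ∧ G.Adj (p i) q := by
    intro i
    obtain ⟨x, y, hxy, hx, hy⟩ := hin i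
    by_cases h : x = z
    · exact ⟨y, fun h' => hxy (h.trans h'.symm), hy⟩
    · exact ⟨x, h, hx⟩
  choose q hqz hq using hq
  let f : Option (Fin 3 × Bool) → V
    | none => z
    | some (i, false) => p i
    | some (i, true) => q i
  -- The null vector of affine E₆: 2·3 = 2+2+2, 2·2 = 3+1, 2·1 = 2.
  let w : Option (Fin 3 × Bool) → ℝ
    | none => 3
    | some (_, false) => 2
    | some (_, true) => 1
  refine hG.not_subharmonic affineE6Adj f w ?_ ?_ ?_ ?_
  · rintro (_ | ⟨i, _ | _⟩) <;> simp [w]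
  · rintro (_ | ⟨i, _ | _⟩) (_ | ⟨j, _ | _⟩) h <;>
      simp only [affineE6Adj, ne_eq, not_true_eq_false, and_false] at h
    · exact hz j
    · exact (hz i).symm
    · obtain ⟨rfl, -⟩ := h
      exact hq i
    · obtain ⟨rfl, -⟩ := h
      exact (hq i).symm
  · rintro (_ | ⟨i, _ | _⟩) (_ | ⟨i', _ | _⟩) (_ | ⟨j, _ | _⟩) h h' hf <;>
      simp only [affineE6Adj, ne_eq, not_true_eq_false, and_false] at h h'
    all_goals first
      | rfl
      | exact absurd hf.symm (hqz _)
      | exact absurd hf (hqz _)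
      | rw [h.1, h'.1]
      | rw [hp hf]
  · have h3 : ∀ i : Fin 3, i = 0 ∨ i = 1 ∨ i = 2 := by decide
    rintro (_ | ⟨i, _ | _⟩)
    · simp [Fintype.sum_option, Fintype.sum_prod_type, affineE6Adj, w]
      norm_num
    · rcases h3 i with rfl | rfl | rfl <;>
      · simp [Fintype.sum_option, Fintype.sum_prod_type, affineE6Adj, w]
        norm_num
    · rcases h3 i with rfl | rfl | rfl <;>
      simp [Fintype.sum_option, Fintype.sum_prod_type, affineE6Adj, w]

/-- Positivity applied to the indicator function of the inner vertices yields one with fewer than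
two inner neighbours, an end of the path that they form. -/
theorem IsPositiveGraph.exists_inner_end (hG : IsPositiveGraph G) (hne : ∃ x, IsInner G x) :
    ∃ e, IsInner G e ∧
      ∀ x y, IsInner G x → IsInner G y → G.Adj e x → G.Adj e y → x = y := by
  classical
  obtain ⟨x, hx⟩ := hne
  obtain ⟨e, he, hlt⟩ := hG (fun s => if IsInner G s then 1 else 0)
    (fun s => by split_ifs <;> norm_num) ⟨x, by simp [hx]⟩
  have hein : IsInner G e := by
    by_contra h
    simp [h] at he
  refine ⟨e, hein, fun x y hx hy hex hey => ?_⟩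
  simp only [hein, if_true, Finset.sum_ite, Finset.sum_const_zero, add_zero, Finset.sum_const,
    nsmul_eq_mul, mul_one, Finset.filter_filter] at hlt
  exact Finset.card_le_one.1 (Nat.lt_succ_iff.1 (by exact_mod_cast hlt)) x (by simp [hx, hex]) y (by simp [hy, hey])

/-- An order on the vertices of a graph that moves along edges of two walkers of the same colour
can only violate by a collision. -/
structure IsCrossingOrder (G : SimpleGraph V) (col : V → ℕ) (R : V → V → Prop) : Prop where
  irrefl : ∀ x, ¬ R x x
  trans : ∀ x y z, R x y → R y z → R x z
  flip : ∀ x y, G.Adj x y → col x % 2 ≠ col y % 2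
  step : ∀ x y x' y', R x y → G.Adj x x' → G.Adj y y' → x' = y' ∨ R x' y'
  total : ∀ x y x' y', x ≠ y → col x % 2 = col y % 2 → G.Adj x x' → G.Adj y y' →
    x' = y' ∨ R x' y' ∨ R y' x'

/-- The graph is a caterpillar: the inner vertices form a spine starting at `e`. Among vertices at
distances of the same parity from `e`, the order compares distances and puts leaves just before the
spine vertex at the same distance. A leaf can only step back to the spine, so two walkers cannot
swap without meeting. -/
theorem IsPositiveGraph.exists_isCrossingOrder (hG : IsPositiveGraph G) (hc : G.Connected) :
    ∃ col R, IsCrossingOrder G col R := by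
  classical
  have htree : G.IsTree := ⟨hc, hG.isAcyclic⟩
  obtain ⟨e, he⟩ : ∃ e, ((∃ x, IsInner G x) → IsInner G e) ∧
      ∀ x y, IsInner G x → IsInner G y → G.Adj e x → G.Adj e y → x = y := by
    by_cases hne : ∃ x, IsInner G x
    · obtain ⟨e, he, he'⟩ := hG.exists_inner_end hne
      exact ⟨e, fun _ => he, he'⟩
    · obtain ⟨e⟩ := hc.nonempty
      exact ⟨e, fun h => absurd h hne, fun x y hx => absurd ⟨x, hx⟩ hne⟩
  obtain ⟨hein, heuniq⟩ := he
  set d : V → ℕ := fun v => G.dist e v with hd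
  have hstep : ∀ x y, G.Adj x y → d x = d y + 1 ∨ d y = d x + 1 := fun x y h =>
    htree.dist_eq_dist_add_one_of_adj e h
  have hd0 : ∀ x, d x = 0 → x = e := fun x h =>
    ((hc e x).dist_eq_zero_iff.1 h).symm
  have hparent : ∀ x n, d x = n + 1 → ∃ p, G.Adj x p ∧ d p = n := by
    intro x n h
    obtain ⟨w, hw⟩ := hc.exists_walk_length_eq_dist x e
    rw [G.dist_comm, show G.dist e x = n + 1 from h] at hw
    cases w with
    | nil => simp at hw
    | @cons _ p _ hp w =>
      have h1 : d p ≤ w.length := (G.dist_comm (u := e)).trans_le (G.dist_le w)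
      rw [SimpleGraph.Walk.length_cons] at hw
      have := hstep x p hp
      exact ⟨p, hp, by omega⟩
  have hinner : ∀ x y, G.Adj x y → d y = d x + 1 → x = e ∨ IsInner G x := by
    intro x y hxy h
    rcases Nat.eq_zero_or_pos (d x) with h0 | h0
    · exact Or.inl (hd0 x h0)
    · obtain ⟨p, hp, hpd⟩ := hparent x (d x - 1) (by omega)
      exact Or.inr ⟨p, y, fun h' => by rw [h'] at hpd; omega, hp, hxy⟩
  -- Two inner children of one spine vertex, together with its inner parent, would be three inner
  -- neighbours. At the root `e` the choice of `e` excludes them.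
  have huniqN : ∀ n x y, IsInner G x → IsInner G y → d x = n → d y = n → x = y := by
    intro n
    induction n with
    | zero => intro x y _ _ hx hy; rw [hd0 x hx, hd0 y hy]
    | succ n ih =>
      intro x y hx hy hdx hdy
      obtain ⟨p, hxp, hp⟩ := hparent x n hdx
      obtain ⟨p', hyp, hp'⟩ := hparent y n hdy
      have hpin : IsInner G p := (hinner p x hxp.symm (by omega)).elim
        (fun h => h ▸ hein ⟨x, hx⟩) id
      have hpin' : IsInner G p' := (hinner p' y hyp.symm (by omega)).elim
        (fun h => h ▸ hein ⟨x, hx⟩) id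
      obtain rfl := ih p p' hpin hpin' hp hp'
      rcases Nat.eq_zero_or_pos n with rfl | hn
      · obtain rfl := hd0 p hp
        exact heuniq x y hx hy hxp.symm hyp.symm
      · obtain ⟨r, hpr, hr⟩ := hparent p (n - 1) (by omega)
        have hrin : IsInner G r := (hinner r p hpr.symm (by omega)).elim
          (fun h => h ▸ hein ⟨x, hx⟩) id
        by_contra hxy
        have hxr : x ≠ r := fun h => by rw [h] at hdx; omega
        have hyr : y ≠ r := fun h => by rw [h] at hdy; omega
        refine hG.not_three_inner p ![x, y, r] ?_ ?_ ?_
        · intro i j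
          fin_cases i <;> fin_cases j <;>
            simp [hxy, hxr, hyr, Ne.symm hxy, Ne.symm hxr, Ne.symm hyr]
        · intro i
          fin_cases i
          exacts [hxp.symm, hyp.symm, hpr]
        · intro i
          fin_cases i
          exacts [hx, hy, hrin]
  -- The offset `1` of a leaf keeps the parity of `d` separate from the position `d x - I x`.
  let I : V → ℕ := fun x => if x = e ∨ IsInner G x then 0 else 1
  have hI : ∀ x, I x = 0 ∨ I x = 1 := fun x => by
    simp only [I]
    split_ifs <;> simp
  have hI0 : ∀ x, I x = 0 → x = e ∨ IsInner G x := fun x h => by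
    by_contra h'
    simp [I, h'] at h
  have huniq : ∀ x y, I x = 0 → I y = 0 → d x = d y → x = y := by
    intro x y hx hy h
    have hde : d e = 0 := by simp [hd]
    rcases hI0 x hx with rfl | hx
    · exact (hd0 y (by omega)).symm
    · rcases hI0 y hy with rfl | hy
      · exact hd0 x (by omega)
      · exact huniqN _ x y hx hy h rfl
  have hleaf : ∀ x x', G.Adj x x' → I x = 1 → I x' = 0 ∧ d x = d x' + 1 := by
    intro x x' h hx
    have hx' : ¬ (x = e ∨ IsInner G x) := fun h' => by simp [I, h'] at hx
    rcases hstep x x' h with h1 | h1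
    · refine ⟨?_, h1⟩
      have := hinner x' x h.symm h1
      simp [I, this]
    · exact absurd (hinner x x' h h1) hx'
  have hIpos : ∀ x, I x = 1 → 1 ≤ d x := by
    intro x hx
    by_contra h
    have := hd0 x (by omega)
    simp [I, this] at hx
  have hkey : ∀ x y x' y', d x % 2 = d y % 2 → d x - I x < d y - I y → G.Adj x x' → G.Adj y y' →
      x' = y' ∨ (d x' % 2 = d y' % 2 ∧ d x' - I x' < d y' - I y') := by
    intro x y x' y' hpar hlt hx hy
    by_cases hne : x' = y'
    · exact Or.inl hne
    · right
      have h1 := hstep x x' hx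
      have h2 := hstep y y' hy
      have h3 := hleaf x x' hx
      have h4 := hleaf y y' hy
      have h5 := hleaf x' x hx.symm
      have h6 := hleaf y' y hy.symm
      have h7 : I x' = 0 → I y' = 0 → d x' ≠ d y' := fun a b c => hne (huniq _ _ a b c)
      have := hI x
      have := hI y
      have := hI x'
      have := hI y'
      omega
  refine ⟨d, fun x y => d x % 2 = d y % 2 ∧ d x - I x < d y - I y, ?_, ?_, ?_, ?_, ?_⟩
  · intro x h
    exact lt_irrefl _ h.2
  · intro x y z h h'
    exact ⟨h.1.trans h'.1, h.2.trans h'.2⟩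
  · intro x y h
    have := hstep x y h
    omega
  · intro x y x' y' h hx hy
    exact hkey x y x' y' h.1 h.2 hx hy
  · intro x y x' y' hne hpar hx hy
    rcases lt_trichotomy (d x - I x) (d y - I y) with h | h | h
    · exact (hkey x y x' y' hpar h hx hy).imp_right Or.inl
    -- Equal positions and equal parity force two leaves at the same distance, which hang on the
    -- same spine vertex.
    · left
      have h3 := hleaf x x' hx
      have h4 := hleaf y y' hy
      have := hIpos x
      have := hIpos y
      have h7 : I x = 0 → I y = 0 → d x ≠ d y := fun a b c => hne (huniq _ _ a b c)
      have h8 := hI x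
      have h9 := hI y
      apply huniq <;> omega
    · rcases hkey y x y' x' hpar.symm h hy hx with h' | h'
      · exact Or.inl h'.symm
      · exact Or.inr (Or.inr h')

end PositiveGraph

/-! ### Potentials on trees -/

/-- On a tree every antisymmetric function on the edges is a coboundary. -/
theorem exists_potential {V A : Type*} [AddCommGroup A] {G : SimpleGraph V} (hG : G.IsTree)
    (d : V → V → A) (hd : ∀ s t, G.Adj s t → d s t + d t s = 0) (r : V) (a : A) :
    ∃ f : V → A, f r = a ∧ ∀ s t, G.Adj s t → f t - f s = d s t := by
  classical
  choose p hp hpu using fun v => hG.existsUnique_path r v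
  let f : V → A := fun v => a + ((p v).darts.map fun e => d e.fst e.snd).sum
  have hstep : ∀ s t, G.Adj s t → t ∉ (p s).support → f t - f s = d s t := by
    intro s t h ht
    have h1 : (p s).concat h = p t := hpu t _ ((hp s).concat ht h)
    simp only [f, ← h1, SimpleGraph.Walk.darts_concat, List.concat_eq_append, List.map_append,
      List.sum_append, List.map_cons, List.map_nil, List.sum_singleton]
    abel
  refine ⟨f, ?_, fun s t h => ?_⟩
  · have : (SimpleGraph.Walk.nil : G.Walk r r) = p r := hpu r _ SimpleGraph.Walk.IsPath.nil
    simp [f, ← this]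
  -- If `t` lies on the path to `s`, then `s` is not on the path to `t`, and antisymmetry lets the
  -- two be exchanged.
  · by_cases ht : t ∈ (p s).support
    · have hs := hG.isAcyclic.ne_mem_support_of_support_of_adj_of_isPath (hp s) (hp t) h ht
      rw [← neg_sub, hstep t s h.symm hs, neg_eq_iff_add_eq_zero, hd _ _ h.symm]
    · exact hstep s t h ht

/-- Two functions on a connected graph with equal differences along edges that agree at one
vertex are equal. -/
theorem eq_of_sub_eq_sub {V A : Type*} [AddCommGroup A] {G : SimpleGraph V} (hG : G.Connected)
    {f g : V → A} (h : ∀ s t, G.Adj s t → f t - f s = g t - g s) {r : V} (hr : f r = g r) :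
    f = g := by
  funext v
  obtain ⟨w⟩ := hG r v
  induction w with
  | nil => exact hr
  | cons hadj _ ih =>
    apply ih
    have := h _ _ hadj
    rw [hr] at this
    exact sub_left_injective this

/-! ### Coxeter elements as orientations of the Coxeter graph -/

section CoxeterElements

variable {B W : Type*} [Group W] {M : CoxeterMatrix B}

theorem pair_sublist_or {α : Type*} {l : List α} {s t : α} (hs : s ∈ l) (ht : t ∈ l)
    (hst : s ≠ t) : [s, t].Sublist l ∨ [t, s].Sublist l := by
  induction l with
  | nil => simp at hs
  | cons a l ih =>
    by_cases h1 : s = a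
    · subst h1
      left
      simpa [hst.symm] using ht
    · by_cases h2 : t = a
      · subst h2
        right
        simpa [hst] using hs
      · exact (ih (by simpa [h1] using hs) (by simpa [h2] using ht)).imp
          (fun h => h.cons a) (fun h => h.cons a)

theorem not_pair_sublist_of_nodup {α : Type*} {l : List α} (hl : l.Nodup) {s t : α}
    (h : [s, t].Sublist l) (h' : [t, s].Sublist l) : False := by
  induction l with
  | nil => simp at h
  | cons a l ih =>
    rw [List.nodup_cons] at hl
    rw [List.sublist_cons_iff] at h h'
    rcases h with h | ⟨r, hr, h⟩ <;> rcases h' with h' | ⟨r', hr', h'⟩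
    · exact ih hl.2 h h'
    · rw [List.cons.injEq] at hr'
      exact hl.1 (hr'.1 ▸ h.subset (by simp))
    · rw [List.cons.injEq] at hr
      exact hl.1 (hr.1 ▸ h'.subset (by simp))
    · rw [List.cons.injEq] at hr hr'
      exact hl.1 (hr'.1 ▸ h.subset (by simp [← hr.2]))

/-- If the letters that do not commute come in the same order in two arrangements of the same
letters, the two words have the same product. -/
theorem wordProd_eq_of_pair_sublist (cs : CoxeterSystem M W) (l : List B) :
    ∀ l' : List B, l.Nodup → l'.Nodup → (∀ s, s ∈ l ↔ s ∈ l') →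
      (∀ s t, (coxeterGraph cs).Adj s t → [s, t].Sublist l → [s, t].Sublist l') →
      cs.wordProd l = cs.wordProd l' := by
  induction l with
  | nil =>
    intro l' _ _ h _
    have : l' = [] := List.eq_nil_iff_forall_not_mem.2 fun s hs => by simpa using (h s).2 hs
    rw [this]
  | cons a l ih =>
    classical
    intro l' hl hl' hmem hord
    have ha : a ∈ l' := (hmem a).1 (by simp)
    obtain ⟨u, v, rfl⟩ := List.append_of_mem ha
    rw [List.nodup_cons] at hl
    have hnd := hl'
    rw [List.nodup_middle, List.nodup_cons] at hnd
    -- A letter before `a` in `l'` comes after `a` in `a :: l`, so it commutes with `a`, and `a` can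
    -- be moved to the front.
    have hcomm : ∀ x ∈ u, Commute (cs.simple a) (cs.simple x) := by
      intro x hx
      by_contra hcon
      have hax : a ≠ x := fun h => hnd.1 (h ▸ by simp [hx])
      have hxl : x ∈ l := by
        have := (hmem x).2 (by simp [hx])
        simpa [hax.symm] using this
      have h1 := hord a x hcon (by simpa using hxl)
      refine not_pair_sublist_of_nodup hl' h1 ?_
      have h2 : [x].Sublist u := by simpa using hx
      have h3 : [a].Sublist (a :: v) := by simp
      exact h2.append h3
    have hcomm' : Commute (cs.simple a) (cs.wordProd u) := by
      apply Commute.list_prod_right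
      intro y hy
      obtain ⟨x, hx, rfl⟩ := List.mem_map.1 hy
      exact hcomm x hx
    have h := ih (u ++ v) hl.2 hnd.2 ?_ ?_
    · rw [cs.wordProd_cons, h, cs.wordProd_append, cs.wordProd_append, cs.wordProd_cons,
        ← mul_assoc, hcomm'.eq, mul_assoc]
    · intro s
      have h1 := hmem s
      by_cases hs : s = a
      · subst hs
        simpa [hl.1] using hnd.1
      · simpa [hs] using h1
    · intro s t hst hsub
      have h1 := hord s t hst (hsub.cons a)
      have hsa : s ≠ a := fun h => hl.1 (h ▸ hsub.subset (by simp))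
      have hta : t ≠ a := fun h => hl.1 (h ▸ hsub.subset (by simp))
      have h2 := h1.filter fun x => decide (x ≠ a)
      have h3 : (u ++ a :: v).filter (fun x => decide (x ≠ a)) = u ++ v := by
        rw [List.filter_append, List.filter_cons_of_neg (by simp), ← List.filter_append,
          List.filter_eq_self]
        intro x hx
        exact decide_eq_true fun h => hnd.1 (h ▸ hx)
      rw [h3] at h2
      simpa [hsa, hta] using h2

variable [Fintype B]

open Classical in
theorem geometricRep_wordProd_of_notMem (cs : CoxeterSystem M W) (t : B) (l : List B)
    (hl : t ∉ l) : geometricRep cs (cs.wordProd l) (0, Pi.single t 1) = (0, Pi.single t 1) := by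
  induction l with
  | nil => simp
  | cons a l ih =>
    rw [List.mem_cons, not_or] at hl
    rw [cs.wordProd_cons, map_mul, LinearEquiv.mul_apply, ih hl.2, geometricRep_simple,
      simpleCoroot_apply]
    simp [Ne.symm hl.1]

-- The image of the fundamental weight of `t` records which neighbours of `t` precede it. Letters
-- after `t` fix the weight, `t` subtracts its simple root, and each earlier letter `a` adds to `p`
-- a nonnegative multiple of its own root, positive if `a` is adjacent to `t`. This makes the
-- orientation depend on the element only.
open Classical in
theorem geometricRep_wordProd_of_mem (cs : CoxeterSystem M W) (t : B) (l : List B)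
    (hnd : l.Nodup) (ht : t ∈ l) :
    ∃ p : B → ℝ, geometricRep cs (cs.wordProd l) (0, Pi.single t 1) = (-p, Pi.single t 1) ∧
      (∀ s, 0 ≤ p s) ∧ (∀ s, s ∉ l → p s = 0) ∧ p t = 1 ∧
      ∀ s, (coxeterGraph cs).Adj s t →
        ([s, t].Sublist l → 0 < p s) ∧ ([t, s].Sublist l → p s = 0) := by
  induction l with
  | nil => simp at ht
  | cons a l ih =>
    rw [List.nodup_cons] at hnd
    by_cases hat : a = t
    · subst hat
      refine ⟨Pi.single a 1, ?_, ?_, ?_, by simp, ?_⟩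
      · rw [cs.wordProd_cons, map_mul, LinearEquiv.mul_apply,
          geometricRep_wordProd_of_notMem cs a l hnd.1, geometricRep_simple, simpleCoroot_apply]
        simp [simpleRoot]
      · intro s
        rw [Pi.single_apply]
        split_ifs <;> norm_num
      · intro s hs
        rw [List.mem_cons, not_or] at hs
        simp [hs.1]
      · intro s hs
        refine ⟨fun h => ?_, fun _ => by simp [hs.ne]⟩
        rw [List.sublist_cons_iff] at h
        rcases h with h | ⟨r, hr, h⟩
        · exact absurd (h.subset (by simp)) hnd.1
        · rw [List.cons.injEq] at hr
          exact absurd hr.1 hs.ne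
    · have htl : t ∈ l := by simpa [Ne.symm hat] using ht
      obtain ⟨p, hp, hp0, hpl, hpt, hps⟩ := ih hnd.2 htl
      have hpa : p a = 0 := hpl a hnd.1
      have hterm : ∀ v, 0 ≤ -(cartanEntry M a v * p v) := by
        intro v
        by_cases hav : a = v
        · rw [← hav, hpa]; simp
        · exact neg_nonneg.2 (mul_nonpos_of_nonpos_of_nonneg (cartanEntry_nonpos M hav) (hp0 v))
      have hφ : simpleCoroot M a (-p, Pi.single t 1) = ∑ v, -(cartanEntry M a v * p v) := by
        rw [simpleCoroot_apply]
        simp [hat]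
      refine ⟨p + Pi.single a (∑ v, -(cartanEntry M a v * p v)), ?_, ?_, ?_, ?_, ?_⟩
      · rw [cs.wordProd_cons, map_mul, LinearEquiv.mul_apply, hp, geometricRep_simple, hφ]
        ext v
        · simp [simpleRoot, Pi.single_apply]
          split_ifs <;> ring
        · simp [simpleRoot]
      · intro s
        refine add_nonneg (hp0 s) ?_
        rw [Pi.single_apply]
        split_ifs
        exacts [Finset.sum_nonneg fun v _ => hterm v, le_rfl]
      · intro s hs
        rw [List.mem_cons, not_or] at hs
        simp [hs.1, hpl s hs.2]
      · simp [Ne.symm hat, hpt]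
      · intro s hs
        constructor
        · intro h
          rw [List.sublist_cons_iff] at h
          rcases h with h | ⟨r, hr, h⟩
          · have hsa : s ≠ a := fun h' => hnd.1 (h' ▸ h.subset (by simp))
            simpa [hsa] using (hps s hs).1 h
          · rw [List.cons.injEq] at hr
            obtain ⟨rfl, -⟩ := hr
            simp only [Pi.add_apply, hpa, zero_add, Pi.single_eq_same]
            refine Finset.sum_pos' (fun v _ => hterm v) ⟨t, Finset.mem_univ _, ?_⟩
            have := cartanEntry_le_neg_one cs hs
            rw [hpt]
            linarith
        · intro h
          rw [List.sublist_cons_iff] at h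
          rcases h with h | ⟨r, hr, h⟩
          · have hsa : s ≠ a := fun h' => hnd.1 (h' ▸ h.subset (by simp))
            simpa [hsa] using (hps s hs).2 h
          · rw [List.cons.injEq] at hr
            exact absurd hr.1.symm hat

/-- The order of two letters that do not commute is the same in all words of a Coxeter element. -/
theorem pair_sublist_of_wordProd_eq (cs : CoxeterSystem M W) {l l' : List B}
    (hl : IsCoxeterWord l) (hl' : IsCoxeterWord l') (h : cs.wordProd l = cs.wordProd l') {s t : B}
    (hst : (coxeterGraph cs).Adj s t) (hsub : [s, t].Sublist l) : [s, t].Sublist l' := by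
  classical
  refine (pair_sublist_or (hl'.mem s) (hl'.mem t) hst.ne).resolve_right fun hcon => ?_
  obtain ⟨p, hp, -, -, -, hps⟩ := geometricRep_wordProd_of_mem cs t l hl.nodup (hl.mem t)
  obtain ⟨q, hq, -, -, -, hqs⟩ := geometricRep_wordProd_of_mem cs t l' hl'.nodup (hl'.mem t)
  rw [h, hq, Prod.mk.injEq, neg_inj] at hp
  have h1 := (hps s hst).1 hsub
  rw [← hp.1, (hqs s hst).2 hcon] at h1
  exact lt_irrefl _ h1

theorem coxeterOrientation_wordProd_adj (cs : CoxeterSystem M W) {l : List B}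
    (hl : IsCoxeterWord l) (s t : B) : (coxeterOrientation cs (cs.wordProd l)).Adj s t ↔
      (coxeterGraph cs).Adj s t ∧ [s, t].Sublist l := by
  constructor
  · rintro ⟨hst, l', hl', h, hsub⟩
    exact ⟨hst, pair_sublist_of_wordProd_eq cs hl' hl h hst hsub⟩
  · rintro ⟨hst, hsub⟩
    exact ⟨hst, l, hl, rfl, hsub⟩

theorem coxeterOrientation_injOn (cs : CoxeterSystem M W) {w w' : W} (hw : w ∈ Cox cs)
    (hw' : w' ∈ Cox cs) (h : coxeterOrientation cs w = coxeterOrientation cs w') : w = w' := by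
  obtain ⟨l, hl, rfl⟩ := hw
  obtain ⟨l', hl', rfl⟩ := hw'
  refine wordProd_eq_of_pair_sublist cs l l' hl.nodup hl'.nodup
    (fun s => by simp [hl.mem, hl'.mem]) fun s t hst hsub => ?_
  have h1 := (coxeterOrientation_wordProd_adj cs hl s t).2 ⟨hst, hsub⟩
  rw [h] at h1
  exact ((coxeterOrientation_wordProd_adj cs hl' s t).1 h1).2

/-- `D` directs every edge of `G` in exactly one way. -/
structure IsOrientation {V : Type*} (G : SimpleGraph V) (D : Digraph V) : Prop where
  adj : ∀ s t, D.Adj s t → G.Adj s t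
  or : ∀ s t, G.Adj s t → D.Adj s t ∨ D.Adj t s
  asymm : ∀ s t, D.Adj s t → ¬ D.Adj t s

theorem isOrientation_coxeterOrientation (cs : CoxeterSystem M W) {w : W} (hw : w ∈ Cox cs) :
    IsOrientation (coxeterGraph cs) (coxeterOrientation cs w) := by
  obtain ⟨l, hl, rfl⟩ := hw
  refine ⟨fun s t h => h.1, fun s t h => ?_, fun s t h h' => ?_⟩
  · rw [coxeterOrientation_wordProd_adj cs hl, coxeterOrientation_wordProd_adj cs hl]
    exact (pair_sublist_or (hl.mem s) (hl.mem t) h.ne).imp (fun h' => ⟨h, h'⟩)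
      (fun h' => ⟨h.symm, h'⟩)
  · rw [coxeterOrientation_wordProd_adj cs hl] at h h'
    exact not_pair_sublist_of_nodup hl.nodup h.2 h'.2

open Classical in
/-- An orientation of a tree has a potential that changes by one along each edge. -/
theorem IsOrientation.exists_height {V : Type*} {G : SimpleGraph V} (hG : G.IsTree)
    {D : Digraph V} (hD : IsOrientation G D) :
    ∃ f : V → ℤ, ∀ s t, G.Adj s t → f t - f s = if D.Adj s t then 1 else -1 := by
  obtain ⟨r⟩ := hG.connected.nonempty
  obtain ⟨f, -, hf⟩ := exists_potential hG (fun s t => if D.Adj s t then (1 : ℤ) else -1)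
    (fun s t h => by
      rcases hD.or s t h with h1 | h1
      · simp [h1, hD.asymm _ _ h1]
      · simp [h1, hD.asymm _ _ h1]) r 0
  exact ⟨f, hf⟩

/-- If the Coxeter graph is a tree, each of its orientations comes from a Coxeter element. -/
theorem exists_coxeterOrientation_eq (cs : CoxeterSystem M W) (hG : (coxeterGraph cs).IsTree)
    {D : Digraph B} (hD : IsOrientation (coxeterGraph cs) D) :
    ∃ w ∈ Cox cs, coxeterOrientation cs w = D := by
  classical
  obtain ⟨f, hf⟩ := hD.exists_height hG
  -- Heights of adjacent generators differ by exactly one, so sorting by height puts them in the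
  -- order given by `D`.
  let l := Finset.univ.toList.mergeSort fun s t : B => decide (f s ≤ f t)
  have hperm : l.Perm (Finset.univ : Finset B).toList := List.mergeSort_perm _ _
  have hl : IsCoxeterWord l :=
    ⟨hperm.nodup_iff.2 (Finset.nodup_toList _), fun s => hperm.mem_iff.2 (by simp)⟩
  have hsorted : l.Pairwise fun s t => f s ≤ f t := by
    have := List.pairwise_mergeSort (le := fun s t : B => decide (f s ≤ f t))
      (fun a b c => by simpa using le_trans) (fun a b => by simpa using le_total _ _)
      Finset.univ.toList
    simpa using this
  refine ⟨_, ⟨l, hl, rfl⟩, ?_⟩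
  have hle : ∀ s t, [s, t].Sublist l → f s ≤ f t := fun s t h => by
    simpa using hsorted.sublist h
  ext s t
  rw [coxeterOrientation_wordProd_adj cs hl]
  constructor
  · rintro ⟨hst, hsub⟩
    have h1 := hf s t hst
    have h2 := hle s t hsub
    by_contra h
    rw [if_neg h] at h1
    omega
  · intro h
    have hst := hD.adj s t h
    refine ⟨hst, (pair_sublist_or (hl.mem s) (hl.mem t) hst.ne).resolve_right fun hsub => ?_⟩
    have h1 := hf s t hst
    have h2 := hle t s hsub
    rw [if_pos h] at h1
    omega

end CoxeterElements

/-! ### Level cuts of the cyclic cover are cut paths -/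

section CyclicCover

variable {J : Type*}

/-- The cover of `G` with fibre `ZMod h` in which the edge from `s` to `t` raises the level
by `ε s t`. -/
def cyclicCover (G : SimpleGraph J) (h : ℕ) (ε : J → J → ℤ) : Digraph (ZMod h × J) where
  Adj σ τ := G.Adj σ.2 τ.2 ∧ τ.1 = σ.1 + ε σ.2 τ.2

/-- The edges that cross the level `a` along the direction `D`. -/
def levelCut (G : SimpleGraph J) (h : ℕ) (ε : J → J → ℤ) (D : Digraph J) (a : J → ZMod h) :
    Set ((ZMod h × J) × (ZMod h × J)) :=
  {e | (cyclicCover G h ε).Adj e.1 e.2 ∧ D.Adj e.1.2 e.2.2 ∧ e.1.1 = a e.1.2 - 1}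

/-- The digraph on the base induced by a set of edges of a cover. -/
def baseDigraph {h : ℕ} (κ : Set ((ZMod h × J) × (ZMod h × J))) : Digraph J where
  Adj s t := ∃ e ∈ κ, e.1.2 = s ∧ e.2.2 = t

open Classical in
/-- `a` is a system of levels compatible with the direction `D`. -/
def IsLevel (G : SimpleGraph J) (h : ℕ) (ε : J → J → ℤ) (D : Digraph J) (a : J → ZMod h) : Prop :=
  ∀ s t, G.Adj s t → a s - a t = (if D.Adj s t then 1 else 0) - (ε s t : ZMod h)

variable {G : SimpleGraph J} {h : ℕ} {ε : J → J → ℤ} {D : Digraph J}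

/-- A closed walk cannot avoid its own translate by an even period. -/
theorem IsCrossingOrder.false_of_periodic {col : J → ℕ} {R : J → J → Prop}
    (hR : IsCrossingOrder G col R) (s : ℕ → J) (hs : ∀ j, G.Adj (s j) (s (j + 1))) {d m : ℕ}
    (hd : Even d) (hm : 0 < m) (hper : ∀ j, s (j + d * m) = s j) (hne : ∀ j, s j ≠ s (j + d)) :
    False := by
  have hcol : ∀ j, col (s (0 + j)) % 2 = (col (s 0) + j) % 2 := by
    intro j
    induction j with
    | zero => rfl
    | succ j ih =>
      have := hR.flip _ _ (hs (0 + j))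
      rw [add_assoc] at this
      omega
  have hne1 : ∀ j, s (j + 1) ≠ s (j + d + 1) := fun j => by
    rw [add_right_comm]
    exact hne (j + 1)
  -- Used for `R` and its reverse. The walkers are compared from time 1 on, as `total` orders them
  -- only after a step; chaining the `m` translates gives `Q (s 1) (s 1)`.
  have key (Q : J → J → Prop) (hQi : ∀ x, ¬ Q x x) (hQt : ∀ x y z, Q x y → Q y z → Q x z)
      (hQs : ∀ x y x' y', Q x y → G.Adj x x' → G.Adj y y' → x' = y' ∨ Q x' y')
      (h0 : Q (s 1) (s (1 + d))) : False := by
    have hall : ∀ j, Q (s (j + 1)) (s (j + d + 1)) := by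
      intro j
      induction j with
      | zero => simpa [add_comm] using h0
      | succ j ih =>
        have := (hQs _ _ _ _ ih (hs (j + 1)) (hs (j + d + 1))).resolve_left (by
          have := hne1 (j + 1)
          rwa [add_right_comm j 1 d] at this)
        rwa [add_right_comm j 1 d]
    have hchain : ∀ n, Q (s 1) (s (d * (n + 1) + 1)) := by
      intro n
      induction n with
      | zero => simpa [add_comm] using h0
      | succ n ih =>
        have := hQt _ _ _ ih (hall (d * (n + 1)))
        rwa [← Nat.mul_succ] at this
    obtain ⟨n, rfl⟩ : ∃ n, m = n + 1 := ⟨m - 1, by omega⟩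
    have := hchain n
    rw [add_comm, hper] at this
    exact hQi _ this
  have hpar : col (s 0) % 2 = col (s (0 + d)) % 2 := by
    obtain ⟨r, rfl⟩ := hd
    have := hcol (r + r)
    omega
  rcases hR.total _ _ _ _ (hne 0) hpar (hs 0) (hs (0 + d)) with h | h | h
  · exact hne1 0 h
  · exact key R hR.irrefl hR.trans hR.step (by simpa [add_comm] using h)
  · exact key (fun x y => R y x) hR.irrefl (fun x y z h h' => hR.trans _ _ _ h' h)
      (fun x y x' y' h hx hy => (hR.step _ _ _ _ h hy hx).imp_left Eq.symm)
      (by simpa [add_comm] using h)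

/-- Along a simple cycle the integer lift `L` of the height never decreases and gains exactly `h` in
total, so it passes from -1 to 0 modulo `h` exactly once. -/
theorem isCutPath_levelCut [NeZero h] (hG : G.IsTree) {col : J → ℕ} {R : J → J → Prop}
    (hR : IsCrossingOrder G col R) (hD : IsOrientation G D) {a : J → ZMod h}
    (ha : IsLevel G h ε D a) : IsCutPath (cyclicCover G h ε) (levelCut G h ε D a) := by
  classical
  refine ⟨fun e he => he.1, fun k v hv => ?_⟩
  obtain ⟨f, hf⟩ := hD.exists_height hG
  have hk := hv.pos
  have : NeZero k := ⟨hk.ne'⟩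
  have hh : 0 < h := Nat.pos_of_ne_zero (NeZero.ne h)
  let x : ℕ → ZMod h := fun j => (v (j : ZMod k)).1
  let s : ℕ → J := fun j => (v (j : ZMod k)).2
  let δ : ℕ → ℤ := fun j => if D.Adj (s j) (s (j + 1)) then 1 else 0
  have hδ : ∀ j, δ j = 0 ∨ δ j = 1 := fun j => by simp only [δ]; split_ifs <;> simp
  have hadj : ∀ j, (cyclicCover G h ε).Adj (x j, s j) (x (j + 1), s (j + 1)) := fun j => by
    have := hv.adj (j : ZMod k)
    rw [← Nat.cast_succ] at this
    exact this
  have hs : ∀ j, G.Adj (s j) (s (j + 1)) := fun j => (hadj j).1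
  let L : ℕ → ℤ := fun j => ((x 0 - a (s 0)).val : ℤ) + ∑ i ∈ Finset.range j, δ i
  have hLs : ∀ j, L (j + 1) = L j + δ j := fun j => by
    simp only [L, Finset.sum_range_succ, add_assoc]
  have hLcast : ∀ j, (L j : ZMod h) = x j - a (s j) := by
    intro j
    induction j with
    | zero => simp [L]
    | succ j ih =>
      have h1 := ha _ _ (hs j)
      have h2 := (hadj j).2
      simp only at h2
      rw [hLs, Int.cast_add, ih, h2]
      have h3 : (δ j : ZMod h) = if D.Adj (s j) (s (j + 1)) then 1 else 0 := by
        simp only [δ]; split_ifs <;> simp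
      rw [h3]
      linear_combination -h1
  -- An edge along `D` changes `L` and `f` by 1 and 1, an edge against `D` by 0 and -1. Closing up
  -- gives the length as twice the gain in `L`.
  have hLpot : ∀ j : ℕ, 2 * L j - f (s j) = 2 * L 0 - f (s 0) + j := by
    intro j
    induction j with
    | zero => simp
    | succ j ih =>
      have h1 := hf _ _ (hs j)
      rw [hLs]
      simp only [δ]
      push_cast
      split_ifs at h1 ⊢ <;> linarith
  have hsk : ∀ j, s (j + k) = s j := fun j => by simp [s]
  have hxk : ∀ j, x (j + k) = x j := fun j => by simp [x]
  have hLk : 2 * (L k - L 0) = k := by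
    have h1 := hLpot k
    have h2 := hsk 0
    rw [zero_add] at h2
    rw [h2] at h1
    linarith
  obtain ⟨w, hw⟩ : (h : ℤ) ∣ L k - L 0 := by
    rw [← ZMod.intCast_zmod_eq_zero_iff_dvd, Int.cast_sub, hLcast, hLcast]
    have h1 := hsk 0
    have h2 := hxk 0
    rw [zero_add] at h1 h2
    rw [h1, h2, sub_self]
  have hkw : (k : ℤ) = 2 * h * w := by rw [← hLk, hw]; ring
  have hwpos : 0 < w := by
    by_contra hneg
    have : (2 * h * w : ℤ) ≤ 0 := mul_nonpos_of_nonneg_of_nonpos (by positivity) (by omega)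
    omega
  lift w to ℕ using hwpos.le
  have hkw' : k = 2 * h * w := by exact_mod_cast hkw
  -- If the base walk repeats after `2 * h` steps, `L` has gained `h`, so the vertex of the cover
  -- repeats too; for `w ≥ 2` this contradicts simplicity. Otherwise the walk avoids its translate.
  have hw1 : w = 1 := by
    by_contra hw1
    refine hR.false_of_periodic s hs (d := 2 * h) (m := w) (by simp) (by omega)
      (fun j => by rw [← hkw', hsk]) fun j hj => ?_
    have h1 := hLpot j
    have h2 := hLpot (j + 2 * h)
    rw [← hj] at h2
    have h3 : L (j + 2 * h) = L j + h := by push_cast at h2; linarith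
    have h4 := hLcast (j + 2 * h)
    rw [h3, ← hj] at h4
    push_cast at h4
    rw [ZMod.natCast_self, add_zero, hLcast] at h4
    have h5 : x j = x (j + 2 * h) := sub_left_injective h4
    have h6 := hv.injective (Prod.ext h5 hj : v (j : ZMod k) = v ((j + 2 * h : ℕ) : ZMod k))
    rw [Nat.cast_add, left_eq_add, ZMod.natCast_eq_zero_iff] at h6
    have h7 := Nat.le_of_dvd (by omega) h6
    have : 2 * h * 2 ≤ k := by rw [hkw']; exact Nat.mul_le_mul_left _ (by omega)
    omega
  have hLkh : L k = L 0 + h := by rw [hw1] at hw; push_cast at hw; linarith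
  have hL0 : 0 ≤ L 0 ∧ L 0 < h := by
    simp only [L, Finset.range_zero, Finset.sum_empty, add_zero]
    exact ⟨by positivity, by exact_mod_cast ZMod.val_lt _⟩
  have hmono : Monotone L := monotone_nat_of_le_succ fun j => by
    have := hδ j
    rw [hLs]
    omega
  have hmem : ∀ i : ZMod k, (v i, v (i + 1)) ∈ levelCut G h ε D a ↔
      δ i.val = 1 ∧ (h : ℤ) ∣ L i.val + 1 := by
    intro i
    have h1 : v i = (x i.val, s i.val) := by simp [x, s]
    have h2 : v (i + 1) = (x (i.val + 1), s (i.val + 1)) := by simp [x, s]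
    rw [h1, h2]
    have h3 := hLcast i.val
    rw [← ZMod.intCast_zmod_eq_zero_iff_dvd, Int.cast_add, h3]
    constructor
    · rintro ⟨-, h4, h5⟩
      simp only at h4 h5
      refine ⟨by simp [δ, h4], ?_⟩
      rw [h5]
      push_cast
      ring
    · rintro ⟨h4, h5⟩
      refine ⟨hadj _, ?_, ?_⟩
      · by_contra hcon
        simp [δ, hcon] at h4
      · push_cast at h5
        simp only
        linear_combination h5
  have hval : ∀ j, j < k → δ j = 1 → (h : ℤ) ∣ L j + 1 → L j = h - 1 := by
    rintro j hj h1 ⟨q, hq⟩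
    have h2 := hmono (Nat.zero_le j)
    have h3 := hmono (Nat.succ_le_of_lt hj)
    rw [hLs] at h3
    have h4 : 0 < q := by
      by_contra hneg
      have : (h * q : ℤ) ≤ 0 := mul_nonpos_of_nonneg_of_nonpos (by positivity) (by omega)
      omega
    have h5 : q < 2 := by
      by_contra hneg
      have : (h * 2 : ℤ) ≤ h * q := mul_le_mul_of_nonneg_left (by omega) (by positivity)
      omega
    have h6 : q = 1 := by omega
    rw [h6] at hq
    omega
  -- Since `L` runs from a value in `[0, h)` to that value plus `h`, the crossing is the unique step
  -- from `h - 1` to `h`.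
  have hex : ∃ j, (h : ℤ) ≤ L j := ⟨k, by omega⟩
  obtain ⟨j, hj⟩ : ∃ j, Nat.find hex = j + 1 := by
    refine ⟨Nat.find hex - 1, (Nat.succ_pred_eq_of_pos ?_).symm⟩
    rw [Nat.find_pos]
    omega
  have hj1 : (h : ℤ) ≤ L (j + 1) := hj ▸ Nat.find_spec hex
  have hj2 : L j < h := not_le.1 (Nat.find_min hex (by omega))
  have hjk : j < k := by
    have : Nat.find hex ≤ k := Nat.find_min' hex (by omega)
    omega
  have hδj := hδ j
  have hLsj := hLs j
  refine ⟨(j : ZMod k), ?_, fun i hi => ?_⟩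
  · simp only
    rw [hmem, ZMod.val_cast_of_lt hjk]
    exact ⟨by omega, ⟨1, by omega⟩⟩
  · simp only at hi
    rw [hmem] at hi
    have h1 := hval _ (ZMod.val_lt i) hi.1 hi.2
    have h2 := hLs i.val
    have h3 : i.val = j := by
      rcases lt_trichotomy i.val j with h4 | h4 | h4
      · have := hmono (show i.val + 1 ≤ j from h4)
        omega
      · exact h4
      · have := hmono (show j + 1 ≤ i.val from h4)
        omega
    rw [← h3, ZMod.natCast_zmod_val]

end CyclicCover

/-! ### Every cut path is a level cut -/

section CutPathLevel

variable {J : Type*} {G : SimpleGraph J} {h : ℕ} {ε : J → J → ℤ} {D : Digraph J}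

/-- The closed walk in the cover that winds once, going forth and back between the fibre of `s` and
the fibre of a neighbour `x i` chosen for each level `i`. -/
def zigzag (ε : J → J → ℤ) (s : J) (x : ZMod h → J) (n : ℕ) : ZMod h × J :=
  if n % 2 = 0 then (((n / 2 : ℕ) : ZMod h), s)
  else (((n / 2 : ℕ) : ZMod h) + ε s (x ((n / 2 : ℕ) : ZMod h)), x ((n / 2 : ℕ) : ZMod h))

theorem zigzag_two_mul (s : J) (x : ZMod h → J) (n : ℕ) :
    zigzag ε s x (2 * n) = ((n : ZMod h), s) := by
  simp [zigzag]

theorem zigzag_two_mul_add_one (s : J) (x : ZMod h → J) (n : ℕ) :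
    zigzag ε s x (2 * n + 1) = ((n : ZMod h) + ε s (x n), x n) := by
  have h1 : (2 * n + 1) / 2 = n := by omega
  simp [zigzag, h1]

theorem zigzag_mod (s : J) (x : ZMod h → J) (n : ℕ) :
    zigzag ε s x (n % (2 * h)) = zigzag ε s x n := by
  simp only [zigzag, Nat.mod_mul_right_mod, Nat.mod_mul_right_div_self, ZMod.natCast_mod]

theorem zigzag_val_natCast [NeZero h] (s : J) (x : ZMod h → J) (n : ℕ) :
    zigzag ε s x (n : ZMod (2 * h)).val = zigzag ε s x n := by
  rw [ZMod.val_natCast, zigzag_mod]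

theorem zigzag_val_add_one [NeZero h] (s : J) (x : ZMod h → J) (m : ZMod (2 * h)) :
    zigzag ε s x (m + 1).val = zigzag ε s x (m.val + 1) := by
  rw [← zigzag_val_natCast s x (m.val + 1), Nat.cast_succ, ZMod.natCast_zmod_val]

theorem isDirectedCycle_zigzag [NeZero h] (hε : ∀ s t, G.Adj s t → ε s t + ε t s = 1) (s : J)
    (x : ZMod h → J) (hx : ∀ i, G.Adj s (x i)) :
    IsDirectedCycle (cyclicCover G h ε) fun m : ZMod (2 * h) => zigzag ε s x m.val := by
  have hh : 0 < h := Nat.pos_of_ne_zero (NeZero.ne h)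
  refine ⟨by omega, fun m m' hmm => ?_, fun m => ?_⟩
  · apply ZMod.val_injective
    have h1 := ZMod.val_lt m
    have h2 := ZMod.val_lt m'
    have hcast : ∀ n n' : ℕ, n < h → n' < h → (n : ZMod h) = n' → n = n' := by
      intro n n' hn hn' heq
      have := congrArg ZMod.val heq
      rwa [ZMod.val_cast_of_lt hn, ZMod.val_cast_of_lt hn'] at this
    rcases Nat.even_or_odd' m.val with ⟨n, hn | hn⟩ <;>
      rcases Nat.even_or_odd' m'.val with ⟨n', hn' | hn'⟩ <;> rw [hn, hn'] at hmm ⊢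
    · rw [zigzag_two_mul, zigzag_two_mul, Prod.mk.injEq] at hmm
      rw [hcast n n' (by omega) (by omega) hmm.1]
    · rw [zigzag_two_mul, zigzag_two_mul_add_one, Prod.mk.injEq] at hmm
      exact absurd hmm.2 (hx _).ne
    · rw [zigzag_two_mul, zigzag_two_mul_add_one, Prod.mk.injEq] at hmm
      exact absurd hmm.2.symm (hx _).ne
    · rw [zigzag_two_mul_add_one, zigzag_two_mul_add_one, Prod.mk.injEq] at hmm
      rw [hmm.2, add_left_inj] at hmm
      rw [hcast n n' (by omega) (by omega) hmm.1]
  · rw [zigzag_val_add_one]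
    rcases Nat.even_or_odd' m.val with ⟨n, hn | hn⟩ <;> rw [hn]
    · rw [zigzag_two_mul, zigzag_two_mul_add_one]
      exact ⟨hx _, rfl⟩
    · rw [zigzag_two_mul_add_one, show 2 * n + 1 + 1 = 2 * (n + 1) by ring, zigzag_two_mul]
      refine ⟨(hx _).symm, ?_⟩
      have := congrArg (Int.cast : ℤ → ZMod h) (hε _ _ (hx (n : ZMod h)))
      push_cast at this ⊢
      rw [add_assoc, this]

/-- The edge of the cover above the edge from `s` to `t` that starts at level `i` is in `κ`. -/
def HasEdge (ε : J → J → ℤ) (κ : Set ((ZMod h × J) × (ZMod h × J))) (s t : J) (i : ZMod h) :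
    Prop :=
  ((i, s), (i + ε s t, t)) ∈ κ

variable {κ : Set ((ZMod h × J) × (ZMod h × J))}

/-- Each level `i` contributes an excursion from `(i, s)` through `x i` to `(i + 1, s)`. Exactly one
excursion of the zigzag is cut, in exactly one of its two edges. -/
theorem existsUnique_hasEdge [NeZero h] (hε : ∀ s t, G.Adj s t → ε s t + ε t s = 1)
    (hκ : IsCutPath (cyclicCover G h ε) κ) (s : J) (x : ZMod h → J) (hx : ∀ i, G.Adj s (x i)) :
    ∃ i, (HasEdge ε κ s (x i) i ∨ HasEdge ε κ (x i) s (i + ε s (x i))) ∧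
      ¬ (HasEdge ε κ s (x i) i ∧ HasEdge ε κ (x i) s (i + ε s (x i))) ∧
      ∀ i', (HasEdge ε κ s (x i') i' ∨ HasEdge ε κ (x i') s (i' + ε s (x i'))) → i' = i := by
  have hh : 0 < h := Nat.pos_of_ne_zero (NeZero.ne h)
  obtain ⟨m, hm, huniq⟩ := hκ.existsUnique _ _ (isDirectedCycle_zigzag hε s x hx)
  simp only [zigzag_val_add_one] at hm huniq
  have hodd : ∀ n : ℕ, (zigzag ε s x (2 * n + 1), zigzag ε s x (2 * n + 1 + 1)) ∈ κ ↔
      HasEdge ε κ (x n) s (n + ε s (x n)) := by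
    intro n
    rw [zigzag_two_mul_add_one, show 2 * n + 1 + 1 = 2 * (n + 1) by ring, zigzag_two_mul, HasEdge]
    have := congrArg (Int.cast : ℤ → ZMod h) (hε _ _ (hx (n : ZMod h)))
    push_cast at this ⊢
    rw [add_assoc, this]
  have heven : ∀ n : ℕ, (zigzag ε s x (2 * n), zigzag ε s x (2 * n + 1)) ∈ κ ↔
      HasEdge ε κ s (x n) n := by
    intro n
    rw [zigzag_two_mul, zigzag_two_mul_add_one, HasEdge]
  have hval : ∀ i : ZMod h, HasEdge ε κ s (x i) i → m.val = 2 * i.val := by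
    intro i hi
    have h1 := ZMod.val_lt i
    rw [← huniq ((2 * i.val : ℕ) : ZMod (2 * h)), ZMod.val_cast_of_lt (by omega)]
    rw [ZMod.val_cast_of_lt (by omega), heven, ZMod.natCast_zmod_val]
    exact hi
  have hval' : ∀ i : ZMod h, HasEdge ε κ (x i) s (i + ε s (x i)) → m.val = 2 * i.val + 1 := by
    intro i hi
    have h1 := ZMod.val_lt i
    rw [← huniq ((2 * i.val + 1 : ℕ) : ZMod (2 * h)), ZMod.val_cast_of_lt (by omega)]
    rw [ZMod.val_cast_of_lt (by omega), hodd, ZMod.natCast_zmod_val]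
    exact hi
  obtain ⟨n, hn, hn'⟩ : ∃ n : ℕ, n < h ∧
      (HasEdge ε κ s (x n) n ∨ HasEdge ε κ (x n) s (n + ε s (x n))) := by
    have h1 := ZMod.val_lt m
    rcases Nat.even_or_odd' m.val with ⟨n, hn | hn⟩ <;> rw [hn] at hm
    · exact ⟨n, by omega, Or.inl ((heven n).1 hm)⟩
    · exact ⟨n, by omega, Or.inr ((hodd n).1 hm)⟩
  refine ⟨n, hn', fun hb => ?_, fun i' hi' => ?_⟩
  · have h1 := hval _ hb.1
    have h2 := hval' _ hb.2
    omega
  · apply ZMod.val_injective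
    have h1 := hi'.imp (hval i') (hval' i')
    have h2 := hn'.imp (hval n) (hval' n)
    omega

theorem IsCutPath.hasEdge_of_mem (hκ : IsCutPath (cyclicCover G h ε) κ) {e} (he : e ∈ κ) :
    G.Adj e.1.2 e.2.2 ∧ HasEdge ε κ e.1.2 e.2.2 e.1.1 := by
  have h1 := hκ.adj e he
  refine ⟨h1.1, ?_⟩
  rw [HasEdge, ← h1.2]
  exact he

theorem baseDigraph_adj (hκ : IsCutPath (cyclicCover G h ε) κ) (s t : J) :
    (baseDigraph κ).Adj s t ↔ ∃ i, HasEdge ε κ s t i := by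
  constructor
  · rintro ⟨e, he, rfl, rfl⟩
    exact ⟨_, (hκ.hasEdge_of_mem he).2⟩
  · rintro ⟨i, hi⟩
    exact ⟨_, hi, rfl, rfl⟩

/-- A cut path crosses each edge of the base in exactly one direction, and all its edges lie at one
level. -/
theorem exists_eq_levelCut [NeZero h] [Nontrivial J] (hG : G.Connected)
    (hε : ∀ s t, G.Adj s t → ε s t + ε t s = 1)
    (hκ : IsCutPath (cyclicCover G h ε) κ) :
    IsOrientation G (baseDigraph κ) ∧
      ∃ a, IsLevel G h ε (baseDigraph κ) a ∧ κ = levelCut G h ε (baseDigraph κ) a := by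
  classical
  have hεh : ∀ s t, G.Adj s t → (ε s t + ε t s : ZMod h) = 1 := fun s t hst => by
    have := congrArg (Int.cast : ℤ → ZMod h) (hε s t hst)
    push_cast at this
    exact this
  have hedge : ∀ s t, G.Adj s t → ∃ i, (HasEdge ε κ s t i ∨ HasEdge ε κ t s (i + ε s t)) ∧
      ¬ (HasEdge ε κ s t i ∧ HasEdge ε κ t s (i + ε s t)) ∧
      ∀ i', (HasEdge ε κ s t i' ∨ HasEdge ε κ t s (i' + ε s t)) → i' = i := fun s t hst =>
    existsUnique_hasEdge hε hκ s (fun _ => t) fun _ => hst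
  have hnb : ∀ s, ∃ t, G.Adj s t := fun s => hG.preconnected.exists_adj_of_nontrivial s
  choose nb hnb using hnb
  have hlev : ∀ s, ∃ i, ∀ t, G.Adj s t → HasEdge ε κ s t i ∨ HasEdge ε κ t s (i + ε s t) := by
    intro s
    obtain ⟨i, hi, -, -⟩ := hedge s (nb s) (hnb s)
    refine ⟨i, fun t hst => ?_⟩
    obtain ⟨j, hj, -, -⟩ := hedge s t hst
    -- If the excursions to `nb s` and to `t` were cut at different levels, this mixed zigzag would
    -- be cut twice.
    obtain ⟨l, -, -, hl⟩ := existsUnique_hasEdge hε hκ s (fun l => if l = i then nb s else t)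
      fun l => by
        split_ifs
        exacts [hnb s, hst]
    by_cases hij : j = i
    · rwa [← hij]
    · have h1 := hl i (by simpa using hi)
      have h2 := hl j (by simpa [hij] using hj)
      exact absurd (h2.trans h1.symm) hij
  choose b hb using hlev
  have huniq : ∀ s t i, G.Adj s t → HasEdge ε κ s t i → i = b s := by
    intro s t i hst hi
    obtain ⟨j, -, -, hj⟩ := hedge s t hst
    rw [hj i (Or.inl hi), ← hj (b s) (hb s t hst)]
  have hasymm : ∀ s t, G.Adj s t → ¬ (HasEdge ε κ s t (b s) ∧ HasEdge ε κ t s (b t)) := by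
    rintro s t hst ⟨h1, h2⟩
    obtain ⟨j, -, hn, hj⟩ := hedge s t hst
    have e1 := hj _ (Or.inl h1)
    have e2 := hj (b t - ε s t) (Or.inr (by rwa [sub_add_cancel]))
    refine hn ⟨e1 ▸ h1, ?_⟩
    rw [← e2, sub_add_cancel]
    exact h2
  have hD : ∀ s t, G.Adj s t → ((baseDigraph κ).Adj s t ↔ HasEdge ε κ s t (b s)) := by
    intro s t hst
    rw [baseDigraph_adj hκ]
    constructor
    · rintro ⟨i, hi⟩
      rwa [← huniq s t i hst hi]
    · exact fun hi => ⟨_, hi⟩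
  have hDadj : ∀ s t, (baseDigraph κ).Adj s t → G.Adj s t := by
    rintro s t ⟨e, he, rfl, rfl⟩
    exact (hκ.hasEdge_of_mem he).1
  have hback : ∀ s t, G.Adj s t → ¬ HasEdge ε κ s t (b s) →
      HasEdge ε κ t s (b t) ∧ b s + ε s t = b t := by
    intro s t hst hn
    have h1 := (hb s t hst).resolve_left hn
    have h2 := huniq t s _ hst.symm h1
    exact ⟨h2 ▸ h1, h2⟩
  -- Edges of a level cut start at level `a s - 1`, whence the shift by one.
  refine ⟨⟨hDadj, fun s t hst => ?_, fun s t h1 h2 => ?_⟩, fun s => b s + 1, ?_, ?_⟩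
  · rw [hD s t hst, hD t s hst.symm]
    by_cases h1 : HasEdge ε κ s t (b s)
    · exact Or.inl h1
    · exact Or.inr (hback s t hst h1).1
  · have hst := hDadj s t h1
    exact hasymm s t hst ⟨(hD s t hst).1 h1, (hD t s hst.symm).1 h2⟩
  · intro s t hst
    simp only [hD s t hst]
    split_ifs with h1
    · have h2 : ¬ HasEdge ε κ t s (b t) := fun h2 => hasymm s t hst ⟨h1, h2⟩
      have h3 := (hback t s hst.symm h2).2
      have := hεh s t hst
      linear_combination this - h3
    · have h3 := (hback s t hst h1).2
      linear_combination h3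
  · ext e
    constructor
    · intro he
      obtain ⟨h1, h2⟩ := hκ.hasEdge_of_mem he
      refine ⟨hκ.adj e he, ⟨e, he, rfl, rfl⟩, ?_⟩
      rw [huniq _ _ _ h1 h2, add_sub_cancel_right]
    · rintro ⟨h1, h2, h3⟩
      have h4 := (hD _ _ h1.1).1 h2
      rw [add_sub_cancel_right] at h3
      rw [HasEdge, ← h3, ← h1.2] at h4
      exact h4

theorem baseDigraph_levelCut (hD : IsOrientation G D) (a : J → ZMod h) :
    baseDigraph (levelCut G h ε D a) = D := by
  ext s t
  constructor
  · rintro ⟨e, ⟨-, he, -⟩, rfl, rfl⟩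
    exact he
  · intro hst
    exact ⟨((a s - 1, s), (a s - 1 + ε s t, t)), ⟨⟨hD.adj s t hst, rfl⟩, hst, rfl⟩, rfl, rfl⟩

theorem levelCut_injective [Nontrivial J] (hG : G.Connected) (hD : IsOrientation G D)
    {a a' : J → ZMod h} (ha : IsLevel G h ε D a) (ha' : IsLevel G h ε D a')
    (heq : levelCut G h ε D a = levelCut G h ε D a') : a = a' := by
  have hsub : ∀ s t, G.Adj s t → a t - a s = a' t - a' s := fun s t hst => by
    rw [← neg_sub, ha s t hst, ← ha' s t hst, neg_sub]
  have key : ∀ s t, D.Adj s t → a s = a' s := by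
    intro s t hst
    have h1 : ((a s - 1, s), (a s - 1 + (ε s t : ZMod h), t)) ∈ levelCut G h ε D a :=
      ⟨⟨hD.adj s t hst, rfl⟩, hst, rfl⟩
    rw [heq] at h1
    exact sub_left_injective h1.2.2
  obtain ⟨r⟩ := hG.nonempty
  obtain ⟨t, hrt⟩ := hG.preconnected.exists_adj_of_nontrivial r
  rcases hD.or r t hrt with h1 | h1
  · exact eq_of_sub_eq_sub hG hsub (key r t h1)
  · exact eq_of_sub_eq_sub hG hsub (key t r h1)

/-- Each orientation of a tree with a crossing order is induced by exactly `h` cut paths. -/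
theorem card_isCutPath_baseDigraph_eq [NeZero h] [Nontrivial J] (hG : G.IsTree)
    {col : J → ℕ} {R : J → J → Prop} (hR : IsCrossingOrder G col R)
    (hε : ∀ s t, G.Adj s t → ε s t + ε t s = 1) (hD : IsOrientation G D) :
    Nat.card {κ : Set ((ZMod h × J) × (ZMod h × J)) //
      IsCutPath (cyclicCover G h ε) κ ∧ baseDigraph κ = D} = h := by
  classical
  obtain ⟨r⟩ := hG.connected.nonempty
  have hpot : ∀ z : ZMod h, ∃ a : J → ZMod h, a r = z ∧ IsLevel G h ε D a := by
    intro z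
    obtain ⟨a, har, ha⟩ := exists_potential hG
      (fun s t => (ε s t : ZMod h) - if D.Adj s t then 1 else 0) (fun s t hst => by
        have h1 := congrArg (Int.cast : ℤ → ZMod h) (hε s t hst)
        push_cast at h1
        rcases hD.or s t hst with h2 | h2
        · simp only [h2, hD.asymm _ _ h2, if_true, if_false]
          linear_combination h1
        · simp only [h2, hD.asymm _ _ h2, if_true, if_false]
          linear_combination h1) r z
    exact ⟨a, har, fun s t hst => by rw [← neg_sub, ha s t hst, neg_sub]⟩
  choose a har ha using hpot
  -- The `h` cut paths are parametrized by the level at the root `r`.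
  let F : ZMod h → {κ : Set ((ZMod h × J) × (ZMod h × J)) //
      IsCutPath (cyclicCover G h ε) κ ∧ baseDigraph κ = D} := fun z =>
    ⟨levelCut G h ε D (a z), isCutPath_levelCut hG hR hD (ha z), baseDigraph_levelCut hD _⟩
  have hF : Function.Bijective F := by
    constructor
    · intro z z' hz
      have h1 := levelCut_injective hG.connected hD (ha z) (ha z') (congrArg Subtype.val hz)
      rw [← har z, h1, har z']
    · rintro ⟨κ, hκ, rfl⟩
      obtain ⟨-, a', ha', hκa⟩ := exists_eq_levelCut hG.connected hε hκ
      refine ⟨a' r, Subtype.ext ?_⟩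
      have h1 : a (a' r) = a' := eq_of_sub_eq_sub hG.connected
        (fun s t hst => by rw [← neg_sub, ha (a' r) s t hst, ← ha' s t hst, neg_sub]) (har _)
      simp only [F]
      rw [h1]
      exact hκa.symm
  rw [← Nat.card_congr (Equiv.ofBijective F hF), Nat.card_zmod]

end CutPathLevel

theorem IsCrossingOrder.comap {V J : Type*} {G : SimpleGraph V} {col : V → ℕ} {R : V → V → Prop}
    (hR : IsCrossingOrder G col R) {f : J → V} (hf : Function.Injective f) :
    IsCrossingOrder (G.comap f) (fun i => col (f i)) fun i j => R (f i) (f j) where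
  irrefl _ := hR.irrefl _
  trans _ _ _ := hR.trans _ _ _
  flip _ _ h := hR.flip _ _ h
  step _ _ _ _ h hx hy := (hR.step _ _ _ _ h hx hy).imp_left fun h => hf h
  total _ _ _ _ hne hc hx hy :=
    (hR.total _ _ _ _ (hf.ne hne) hc hx hy).imp_left fun h => hf h

/-- The number of copies between a letter at position `i` and the next letter at position `j`. -/
def copyShift {n : ℕ} (i j : Fin n) : ℤ := if i < j then 0 else 1

theorem copyShift_add_copyShift {n : ℕ} {i j : Fin n} (h : i ≠ j) :
    copyShift i j + copyShift j i = 1 := by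
  unfold copyShift
  rcases lt_or_gt_of_ne h with h | h
  · simp [h, h.le]
  · simp [h, h.le]

/-! ### The 2-cover as a cyclic cover -/

section TwoCover

variable {B W : Type*} [Group W] {M : CoxeterMatrix B}

/-- The Coxeter graph on the positions of a word. -/
def positionGraph (cs : CoxeterSystem M W) (c : List B) : SimpleGraph (Fin c.length) :=
  (coxeterGraph cs).comap c.get

theorem get_bijective {c : List B} (hc : IsCoxeterWord c) : Function.Bijective c.get :=
  ⟨List.nodup_iff_injective_get.1 hc.nodup, fun s => List.get_of_mem (hc.mem s)⟩

theorem isTree_positionGraph (cs : CoxeterSystem M W) {c : List B} (hc : IsCoxeterWord c)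
    (hG : (coxeterGraph cs).IsTree) : (positionGraph cs c).IsTree :=
  (SimpleGraph.Iso.comap (Equiv.ofBijective c.get (get_bijective hc))
    (coxeterGraph cs)).isTree_iff.2 hG

/-- If the Coxeter graph is a tree, a letter of `c^∞` is covered exactly by the next copies of its
neighbours. -/
theorem hasseDiagram_adj (cs : CoxeterSystem M W) {c : List B}
    (hG : (positionGraph cs c).IsTree) (p q : InfLetter c) :
    (hasseDiagram cs (infGen c)).Adj p q ↔
      (positionGraph cs c).Adj (ofLex p).2 (ofLex q).2 ∧
        ((ofLex q).1 : ℤ) = (ofLex p).1 + copyShift (ofLex p).2 (ofLex q).2 := by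
  classical
  let D : Digraph (Fin c.length) := ⟨fun i j => (positionGraph cs c).Adj i j ∧ i < j⟩
  have hD : IsOrientation (positionGraph cs c) D :=
    ⟨fun i j h => h.1, fun i j h => (lt_or_gt_of_ne h.ne).imp (fun h' => ⟨h, h'⟩)
      fun h' => ⟨h.symm, h'⟩, fun i j h h' => lt_asymm h.2 h'.2⟩
  obtain ⟨f, hf⟩ := hD.exists_height hG
  have hf' : ∀ i j, (positionGraph cs c).Adj i j → f j - f i = 1 - 2 * copyShift i j := by
    intro i j hij
    rw [hf i j hij, copyShift]
    by_cases h : i < j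
    · simp [D, h, hij]
    · simp [D, h]
  have hlt : ∀ p q : InfLetter c, (positionGraph cs c).Adj (ofLex p).2 (ofLex q).2 →
      (p < q ↔ ((ofLex p).1 : ℤ) + copyShift (ofLex p).2 (ofLex q).2 ≤ (ofLex q).1) := by
    intro p q h
    rw [Prod.Lex.lt_iff, copyShift]
    split_ifs with h1
    · simp only [h1, and_true]
      omega
    · simp only [h1, and_false, or_false]
      omega
  -- A rank function: it increases strictly along the natural order, and by exactly one from a
  -- letter to the next copy of a neighbour, so nothing lies in between.
  let y : InfLetter c → ℤ := fun p => 2 * (ofLex p).1 + f (ofLex p).2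
  have hbase : ∀ p q : InfLetter c,
      (p < q ∧ ¬ Commute (cs.simple (infGen c p)) (cs.simple (infGen c q))) ↔
      ((positionGraph cs c).Adj (ofLex p).2 (ofLex q).2 ∧
        ((ofLex p).1 : ℤ) + copyShift (ofLex p).2 (ofLex q).2 ≤ (ofLex q).1) := by
    intro p q
    constructor
    · rintro ⟨h1, h2⟩
      exact ⟨h2, (hlt p q h2).1 h1⟩
    · rintro ⟨h1, h2⟩
      exact ⟨(hlt p q h1).2 h2, h1⟩
  have hy : ∀ p q, naturalLT cs (infGen c) p q → y p < y q := by
    intro p q h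
    have hstep : ∀ p q : InfLetter c,
        (p < q ∧ ¬ Commute (cs.simple (infGen c p)) (cs.simple (infGen c q))) → y p < y q := by
      intro p q h
      obtain ⟨h1, h2⟩ := (hbase p q).1 h
      have := hf' _ _ h1
      simp only [y]
      omega
    induction h with
    | single h => exact hstep _ _ h
    | tail _ h ih => exact ih.trans (hstep _ _ h)
  constructor
  · rintro ⟨h, hcov⟩
    rw [naturalLT, Relation.TransGen.head'_iff] at h
    obtain ⟨r, hpr, hrq⟩ := h
    rcases Relation.reflTransGen_iff_eq_or_transGen.1 hrq with rfl | hrq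
    · obtain ⟨h1, h2⟩ := (hbase p q).1 hpr
      refine ⟨h1, le_antisymm ?_ h2⟩
      by_contra! hcon
      have hε := copyShift_add_copyShift h1.ne
      have hε0 : copyShift (ofLex p).2 (ofLex q).2 = 0 ∨ copyShift (ofLex p).2 (ofLex q).2 = 1 := by
        unfold copyShift
        split_ifs <;> simp
      -- If `q` is not the next copy of its generator after `p`, that next copy and then the next
      -- copy of the generator of `p` fit in between.
      let r₁ : InfLetter c :=
        toLex ((ofLex p).1 + (copyShift (ofLex p).2 (ofLex q).2).toNat, (ofLex q).2)
      let r₂ : InfLetter c := toLex ((ofLex p).1 + 1, (ofLex p).2)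
      have e1 : naturalLT cs (infGen c) p r₁ := Relation.TransGen.single <| (hbase _ _).2
        ⟨h1, by simp only [r₁, ofLex_toLex]; push_cast; omega⟩
      have e2 : naturalLT cs (infGen c) r₁ r₂ := Relation.TransGen.single <| (hbase _ _).2
        ⟨h1.symm, by simp only [r₁, r₂, ofLex_toLex]; push_cast; omega⟩
      have e3 : naturalLT cs (infGen c) r₂ q := Relation.TransGen.single <| (hbase _ _).2
        ⟨h1, by simp only [r₂, ofLex_toLex]; push_cast; omega⟩
      exact hcov ⟨r₂, e1.trans e2, e3⟩
    · exact absurd ⟨r, Relation.TransGen.single hpr, hrq⟩ hcov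
  · rintro ⟨h1, h2⟩
    refine ⟨Relation.TransGen.single ((hbase p q).2 ⟨h1, h2.ge⟩), ?_⟩
    rintro ⟨r, hpr, hrq⟩
    have h3 := hy p r hpr
    have h4 := hy r q hrq
    have h5 := hf' _ _ h1
    simp only [y] at h3 h4
    omega

theorem twoCover_eq_cyclicCover (cs : CoxeterSystem M W) {c : List B}
    (hG : (positionGraph cs c).IsTree) [NeZero (coxeterNumber cs c)] :
    twoCover cs c = cyclicCover (positionGraph cs c) (coxeterNumber cs c) copyShift := by
  ext ⟨i, s⟩ ⟨j, t⟩
  constructor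
  · rintro ⟨p, q, hpq, hp, hq⟩
    rw [hasseDiagram_adj cs hG] at hpq
    obtain ⟨rfl, rfl⟩ := Prod.mk.inj hp
    obtain ⟨rfl, rfl⟩ := Prod.mk.inj hq
    refine ⟨hpq.1, ?_⟩
    have := congrArg (Int.cast : ℤ → ZMod (coxeterNumber cs c)) hpq.2
    push_cast at this
    exact this
  · rintro ⟨h1, h2⟩
    simp only at h1 h2
    have hε : 0 ≤ copyShift s t := by
      unfold copyShift
      split_ifs <;> simp
    refine ⟨toLex (i.val, s), toLex (i.val + (copyShift s t).toNat, t), ?_, ?_, ?_⟩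
    · rw [hasseDiagram_adj cs hG]
      refine ⟨h1, ?_⟩
      simp only [ofLex_toLex]
      push_cast
      omega
    · simp [coverProj]
    · have : ((copyShift s t).toNat : ZMod (coxeterNumber cs c)) = (copyShift s t : ℤ) := by
        rw [← Int.cast_natCast, Int.toNat_of_nonneg hε]
      simp [coverProj, this, h2]

end TwoCover

/-! ### Counting orientations and Coxeter elements -/

/-- A finite graph with an orientation has `2 ^ e` orientations, where `e` is its number of
edges. -/
theorem card_isOrientation {V : Type*} [Finite V] {G : SimpleGraph V} {D₀ : Digraph V}
    (hD₀ : IsOrientation G D₀) :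
    Nat.card {D : Digraph V // IsOrientation G D} = 2 ^ Nat.card G.edgeSet := by
  classical
  have := Fintype.ofFinite V
  -- `S` is the set of edges on which the orientation agrees with `D₀`.
  let F : Set G.edgeSet → {D : Digraph V // IsOrientation G D} := fun S =>
    ⟨⟨fun s t => ∃ h : G.Adj s t, (⟨s(s, t), h⟩ : G.edgeSet) ∈ S ↔ D₀.Adj s t⟩,
      fun s t h => h.1, fun s t h => by
        have h1 := hD₀.or s t h
        have h2 := hD₀.asymm s t
        have h3 : (⟨s(s, t), h⟩ : G.edgeSet) = ⟨s(t, s), h.symm⟩ := Subtype.ext Sym2.eq_swap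
        simp only [h, h.symm, exists_true_left, ← h3]
        tauto, fun s t ⟨h, h'⟩ ⟨_, h''⟩ => by
        have h1 := hD₀.or s t h
        have h2 := hD₀.asymm s t
        have h3 : (⟨s(s, t), h⟩ : G.edgeSet) = ⟨s(t, s), h.symm⟩ := Subtype.ext Sym2.eq_swap
        rw [← h3] at h''
        tauto⟩
  have hF : Function.Bijective F := by
    constructor
    · intro S S' hS
      ext ⟨e, he⟩
      induction e with
      | h s t =>
        have h1 : (F S).1.Adj s t ↔ (F S').1.Adj s t := by rw [hS]
        have hst : G.Adj s t := he
        simp only [F, hst, exists_true_left] at h1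
        tauto
    · rintro ⟨D, hD⟩
      refine ⟨{e | ∃ s t, e.1 = s(s, t) ∧ D.Adj s t ∧ D₀.Adj s t}, Subtype.ext ?_⟩
      ext s t
      have hmem : ∀ h : G.Adj s t, (⟨s(s, t), h⟩ : G.edgeSet) ∈
          {e : G.edgeSet | ∃ s t, e.1 = s(s, t) ∧ D.Adj s t ∧ D₀.Adj s t} ↔
          (D.Adj s t ∧ D₀.Adj s t) ∨ (D.Adj t s ∧ D₀.Adj t s) := by
        intro h
        constructor
        · rintro ⟨s', t', he, h'⟩
          rcases Sym2.eq_iff.1 he with ⟨rfl, rfl⟩ | ⟨rfl, rfl⟩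
          · exact Or.inl h'
          · exact Or.inr h'
        · rintro (h' | h')
          · exact ⟨s, t, rfl, h'⟩
          · exact ⟨t, s, Sym2.eq_swap, h'⟩
      simp only [F, hmem]
      have h0 := hD.adj s t
      have h1 := hD.or s t
      have h2 := hD.asymm s t
      have h3 := hD₀.or s t
      have h4 := hD₀.asymm s t
      by_cases hst : G.Adj s t
      · simp only [hst, exists_true_left]
        have h1 := h1 hst
        have h3 := h3 hst
        tauto
      · simp only [hst, IsEmpty.exists_iff, false_iff]
        exact fun h => hst (h0 h)
  rw [← Nat.card_congr (Equiv.ofBijective F hF), Nat.card_eq_fintype_card, Fintype.card_set,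
    Nat.card_eq_fintype_card]

theorem card_cox {B W : Type*} [Fintype B] [Group W] {M : CoxeterMatrix B}
    (cs : CoxeterSystem M W) (hG : (coxeterGraph cs).IsTree) {c : List B} (hc : IsCoxeterWord c) :
    Nat.card (Cox cs) = 2 ^ (Fintype.card B - 1) := by
  classical
  let F : Cox cs → {D : Digraph B // IsOrientation (coxeterGraph cs) D} := fun w =>
    ⟨coxeterOrientation cs w, isOrientation_coxeterOrientation cs w.2⟩
  have hF : Function.Bijective F := by
    constructor
    · intro w w' h
      exact Subtype.ext (coxeterOrientation_injOn cs w.2 w'.2 (congrArg Subtype.val h))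
    · rintro ⟨D, hD⟩
      obtain ⟨w, hw, h⟩ := exists_coxeterOrientation_eq cs hG hD
      exact ⟨⟨w, hw⟩, Subtype.ext h⟩
  rw [Nat.card_congr (Equiv.ofBijective F hF),
    card_isOrientation (isOrientation_coxeterOrientation cs ⟨c, hc, rfl⟩)]
  have := hG.card_edgeFinset
  rw [← this, Nat.add_sub_cancel, Nat.card_eq_fintype_card, SimpleGraph.edgeFinset_card]

/-! ### Transfer between positions and generators, and the main theorem -/

section Main

variable {B W : Type*} [Group W] {M : CoxeterMatrix B}

theorem CutPath.orientation_adj_get {cs : CoxeterSystem M W} {c : List B} (hc : IsCoxeterWord c)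
    (κ : CutPath cs c) (i j : Fin c.length) :
    κ.orientation.Adj (c.get i) (c.get j) ↔ (baseDigraph κ.1).Adj i j := by
  have hinj := (get_bijective hc).1
  constructor
  · rintro ⟨e, he, h1, h2⟩
    exact ⟨e, he, hinj h1, hinj h2⟩
  · rintro ⟨e, he, rfl, rfl⟩
    exact ⟨e, he, rfl, rfl⟩

theorem CutPath.orientation_eq_iff {cs : CoxeterSystem M W} {c : List B} (hc : IsCoxeterWord c)
    (κ : CutPath cs c) (D : Digraph B) :
    κ.orientation = D ↔ baseDigraph κ.1 = ⟨fun i j => D.Adj (c.get i) (c.get j)⟩ := by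
  constructor
  · rintro rfl
    ext i j
    exact (κ.orientation_adj_get hc i j).symm
  · intro h
    ext s t
    obtain ⟨i, rfl⟩ := (get_bijective hc).2 s
    obtain ⟨j, rfl⟩ := (get_bijective hc).2 t
    rw [κ.orientation_adj_get hc, h]

theorem IsOrientation.comap {V J : Type*} {G : SimpleGraph V} {D : Digraph V}
    (hD : IsOrientation G D) (f : J → V) :
    IsOrientation (G.comap f) ⟨fun i j => D.Adj (f i) (f j)⟩ :=
  ⟨fun _ _ => hD.adj _ _, fun _ _ => hD.or _ _, fun _ _ => hD.asymm _ _⟩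

theorem IsOrientation.of_comap {V J : Type*} {G : SimpleGraph V} {D : Digraph V} {f : J → V}
    (hf : Function.Surjective f)
    (hD : IsOrientation (G.comap f) ⟨fun i j => D.Adj (f i) (f j)⟩) : IsOrientation G D := by
  refine ⟨fun s t => ?_, fun s t => ?_, fun s t => ?_⟩ <;>
    obtain ⟨i, rfl⟩ := hf s <;> obtain ⟨j, rfl⟩ := hf t
  exacts [hD.adj i j, hD.or i j, hD.asymm i j]

end Main

end CutPaths

theorem mainTheorem5 {B W : Type*} [Fintype B] [Group W] [Finite W] {M : CoxeterMatrix B}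
    (cs : CoxeterSystem M W) (hirr : CutPaths.IsIrreducible cs) (hrank : 2 ≤ Fintype.card B)
    (c : List B) (hc : CutPaths.IsCoxeterWord c) :
    ∃ Φ : CutPaths.CutPath cs c → CutPaths.Cox cs,
      (∀ (κ : CutPaths.CutPath cs c) (w : W), κ.Induces w ↔ w = Φ κ) ∧
      Function.Surjective Φ ∧
      (∀ w : CutPaths.Cox cs,
        Nat.card {κ : CutPaths.CutPath cs c // Φ κ = w} = CutPaths.coxeterNumber cs c) ∧
      Nat.card (CutPaths.CutPath cs c) =
        2 ^ (Fintype.card B - 1) * CutPaths.coxeterNumber cs c := by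
  open CutPaths in
  classical
  have hpos : IsPositiveGraph (coxeterGraph cs) := fun b hb hb0 =>
    exists_sum_neighbors_lt cs b hb hb0
  have hΓ : (coxeterGraph cs).IsTree := ⟨hirr, hpos.isAcyclic⟩
  have hG := isTree_positionGraph cs hc hΓ
  obtain ⟨col, R, hR⟩ := hpos.exists_isCrossingOrder hirr
  have hR' := hR.comap (get_bijective hc).1
  have hh : 0 < coxeterNumber cs c := orderOf_pos _
  have : NeZero (coxeterNumber cs c) := ⟨hh.ne'⟩
  have : Nontrivial B := Fintype.one_lt_card_iff_nontrivial.1 hrank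
  have : Nontrivial (Fin c.length) := (get_bijective hc).2.nontrivial
  have hε : ∀ s t, (positionGraph cs c).Adj s t → copyShift s t + copyShift t s = 1 :=
    fun s t h => copyShift_add_copyShift h.ne
  have hcover := twoCover_eq_cyclicCover cs hG
  have horient (κ : CutPath cs c) : IsOrientation (coxeterGraph cs) κ.orientation := by
    refine IsOrientation.of_comap (get_bijective hc).2 ?_
    rw [← (κ.orientation_eq_iff hc _).1 rfl]
    have hκ : IsCutPath (cyclicCover (positionGraph cs c) (coxeterNumber cs c) copyShift) κ.1 := by
      rw [← hcover]
      exact κ.2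
    exact (exists_eq_levelCut hG.connected hε hκ).1
  choose Φ hΦ hΦo using fun κ : CutPath cs c => exists_coxeterOrientation_eq cs hΓ (horient κ)
  have hcard (w : Cox cs) :
      Nat.card {κ : CutPath cs c // (⟨Φ κ, hΦ κ⟩ : Cox cs) = w} = coxeterNumber cs c := by
    have hw := (isOrientation_coxeterOrientation cs w.2).comap c.get
    have hcut := card_isCutPath_baseDigraph_eq (h := coxeterNumber cs c) hG hR' hε hw
    rw [← hcover] at hcut
    refine (Nat.card_congr ((Equiv.subtypeEquivRight fun κ => ?_).trans
      (Equiv.subtypeSubtypeEquivSubtypeInter _ _))).trans hcut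
    rw [← CutPath.orientation_eq_iff hc κ, ← hΦo κ]
    constructor
    · rintro rfl
      rfl
    · exact fun h => Subtype.ext (coxeterOrientation_injOn cs (hΦ κ) w.2 h)
  refine ⟨fun κ => ⟨Φ κ, hΦ κ⟩, fun κ w => ⟨fun hw => ?_, ?_⟩, fun w => ?_, hcard, ?_⟩
  · exact coxeterOrientation_injOn cs hw.1 (hΦ κ) (hw.2.trans (hΦo κ).symm)
  · rintro rfl
    exact ⟨hΦ κ, hΦo κ⟩
  -- Surjectivity follows from the count: every fibre has `h > 0` elements.
  · have h1 : Nat.card {κ : CutPath cs c // (⟨Φ κ, hΦ κ⟩ : Cox cs) = w} ≠ 0 := by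
      rw [hcard]
      exact hh.ne'
    obtain ⟨⟨κ, hκ⟩⟩ := (Nat.card_ne_zero.1 h1).1
    exact ⟨κ, hκ⟩
  · have := Fintype.ofFinite (Cox cs)
    rw [← Nat.card_congr (Equiv.sigmaFiberEquiv fun κ : CutPath cs c => (⟨Φ κ, hΦ κ⟩ : Cox cs)),
      Nat.card_sigma, Finset.sum_congr rfl fun w _ => hcard w, Finset.sum_const, smul_eq_mul,
      Finset.card_univ, ← Nat.card_eq_fintype_card, card_cox cs hΓ hc]
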